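/- Let $(X,\varrho)$ be a complete separable metric space with at least two points, and let $\mu$ be a Borel measure on $X$ that is Ahlfors regular of dimension $d>0$: for some $C>0$, $C^{-1}r^d\le\mu(B(x,r))\le Cr^d$ for all $x\in X$ and $0<r\le\operatorname{diam}(X)$ (open balls). Let $\alpha>1$, let $\mathcal E=\{\epsilon_j\}$ be a sequence of positive numbers with $\epsilon_j\to0$, let $c_1,C_1>0$, and for each $j\in\mathbb N$ let $A_j\subset X$ be a $(c_1,C_1,\epsilon_j)$-net, i.e. $\varrho(x,y)>2c_1\epsilon_j$ for distinct $x,y\in A_j$, and every point of $X$ is at distance less than $C_1\epsilon_j$ from some point of $A_j$. Let $$F=\bigcap_{j}\bigcup_{i\ge j}\ \bigcup_{x\in A_i}B(x,\epsilon_i^{\alpha})$$ be the set of $(\mathcal E,\alpha)$-approximable points. For $s>0$ let $\mathcal H^s_\infty(E)=\inf\{\sum_n\operatorname{diam}(E_n)^s: E\subset\bigcup_nE_n\}$ (countable coverings) be the Hausdorff content. A set $G\subset X$ belongs to the class $\mathcal G^s$ if it is a $G_\delta$ set and there is $0<c\le1$ such that $\mathcal H^s_\infty(G\cap U)\ge c\,\mathcal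 H^s_\infty(U)$ for all open $U\subset X$. A dyadic decomposition of $X$ consists of constants $0<\delta<1$, $\delta\le\operatorname{diam}(X)$ and $K\ge1$, and, for each level $j\in\mathbb N$, of a family of Borel sets (dyadic cubes) covering $X$, such that each cube $Q$ of level $j$ contains a point $x$ with $B(x,\delta^j)\subset Q\subset B(x,K\delta^j)$, and, for $i\ge j$, each cube of level $i$ is either contained in or disjoint from each cube of level $j$. Its net content is $\mathcal D^s_\infty(E)=\inf\{\sum_n\mu(Q_n)^{s/d}:E\subset\bigcup_nQ_n\}$, over countable coverings by dyadic cubes. Then: 1. For every $0<s<d/\alpha$, $F\in\mathcal G^s$. Equivalently, in terms of cubes, for every dyadic decomposition of $X$ there is $0<c\le1$ with $\mathcal D^s_\infty(F\cap U)\ge c\,\mathcal D^s_\infty(U)$ for all open $U\subset X$ (and $F$ is a $G_\delta$ set). 2. $\dim_{\mathcal H}F\ge d/\alpha$. 3. If $\mathcal E$ decays exponentially, i.e. $\limsup_{j\to\infty}\frac{\log\epsilon_j}{j}<0$, then $\dim_{\mathcal H}F=d/\alpha$. -/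

import Mathlib

open Set Filter Topology MeasureTheory

/-- The measure `μ` is Ahlfors regular of dimension `d > 0`: there is `C > 0` such that
`C⁻¹ r ^ d ≤ μ (B(x, r)) ≤ C r ^ d` for all points `x` and all `0 < r ≤ diam X` (for an unbounded
space, all `r > 0`), where `B(x, r)` is the open ball. -/
def IsAhlforsRegular {X : Type*} [MetricSpace X] [MeasurableSpace X]
    (μ : Measure X) (d : ℝ) : Prop :=
  0 < d ∧ ∃ C : ℝ, 0 < C ∧ ∀ (x : X) (r : ℝ), 0 < r →
    ENNReal.ofReal r ≤ Metric.ediam (univ : Set X) →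
      ENNReal.ofReal (C⁻¹ * r ^ d) ≤ μ (Metric.ball x r) ∧
        μ (Metric.ball x r) ≤ ENNReal.ofReal (C * r ^ d)

/-- The `s`-dimensional Hausdorff content of `E` (used for `s > 0`): the infimum of
`∑ diam (t n) ^ s` over all countable coverings of `E`, without restriction on the diameters. -/
noncomputable def hausdorffContent {X : Type*} [MetricSpace X] (s : ℝ) (E : Set X) : ENNReal :=
  ⨅ (t : ℕ → Set X) (_ : E ⊆ ⋃ n, t n), ∑' n, Metric.ediam (t n) ^ s

/-- The class `𝒢ˢ` of sets with large intersections: `G_δ` sets `F` for which there is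
`0 < c ≤ 1` such that the Hausdorff content of `F ∩ U` is at least `c` times that of `U`,
for all open sets `U`. -/
def IsGsSet {X : Type*} [MetricSpace X] (s : ℝ) (F : Set X) : Prop :=
  IsGδ F ∧ ∃ c : ℝ, 0 < c ∧ c ≤ 1 ∧ ∀ U : Set X, IsOpen U →
    ENNReal.ofReal c * hausdorffContent s U ≤ hausdorffContent s (F ∩ U)

/-- A dyadic decomposition of `X`, of parameters `δ` and `K`. The set `cubes j` consists of the
dyadic cubes of level `j`. -/
structure DyadicDecomposition (X : Type*) [MetricSpace X] [MeasurableSpace X] where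
  /-- the ratio between consecutive scales -/
  δ : ℝ
  /-- the quasi-ball constant -/
  K : ℝ
  /-- the dyadic cubes of each level -/
  cubes : ℕ → Set (Set X)
  δ_pos : 0 < δ
  δ_lt_one : δ < 1
  δ_le_diam : ENNReal.ofReal δ ≤ Metric.ediam (univ : Set X)
  one_le_K : 1 ≤ K
  measurable : ∀ j, ∀ Q ∈ cubes j, MeasurableSet Q
  covers : ∀ j, ⋃₀ cubes j = univ
  quasiBall : ∀ j, ∀ Q ∈ cubes j, ∃ x ∈ Q,
    Metric.ball x (δ ^ j) ⊆ Q ∧ Q ⊆ Metric.ball x (K * δ ^ j)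
  nested : ∀ i j, j ≤ i → ∀ P ∈ cubes i, ∀ Q ∈ cubes j, P ⊆ Q ∨ Disjoint P Q

/-- The net content `𝒟ˢ_∞` of `E` (used for `s > 0`): the infimum of `∑ μ (Q n) ^ (s / d)` over all
countable coverings of `E` by dyadic cubes. The empty set is allowed as a member of the sequence, so
that finite coverings are included. -/
noncomputable def netContent {X : Type*} [MetricSpace X] [MeasurableSpace X]
    (𝒬 : DyadicDecomposition X) (μ : Measure X) (d s : ℝ) (E : Set X) : ENNReal :=
  ⨅ (t : ℕ → Set X) (_ : ∀ n, t n = ∅ ∨ ∃ j, t n ∈ 𝒬.cubes j) (_ : E ⊆ ⋃ n, t n),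
    ∑' n, μ (t n) ^ (s / d)

/-- The class `𝒢ˢ` expressed through the net content of a dyadic decomposition. -/
def IsNetGsSet {X : Type*} [MetricSpace X] [MeasurableSpace X]
    (𝒬 : DyadicDecomposition X) (μ : Measure X) (d s : ℝ) (F : Set X) : Prop :=
  IsGδ F ∧ ∃ c : ℝ, 0 < c ∧ c ≤ 1 ∧ ∀ U : Set X, IsOpen U →
    ENNReal.ofReal c * netContent 𝒬 μ d s U ≤ netContent 𝒬 μ d s (F ∩ U)

/-- `A` is a `(c₁, C₁, ε)`-net: distinct points of `A` are at distance more than `2 c₁ ε`, and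
every point of the space is at distance less than `C₁ ε` from `A`. -/
def IsNet {X : Type*} [MetricSpace X] (c₁ C₁ ε : ℝ) (A : Set X) : Prop :=
  (∀ x ∈ A, ∀ y ∈ A, x ≠ y → 2 * c₁ * ε < dist x y) ∧ ∀ x : X, ∃ y ∈ A, dist x y < C₁ * ε

/-- The set of approximable points: the limit superior, as `j → ∞`, of the unions of the open balls
of radius `ε j ^ α` centred at the points of `A j`. -/
def approximablePoints {X : Type*} [MetricSpace X] (ε : ℕ → ℝ) (α : ℝ) (A : ℕ → Set X) : Set X :=
  ⋂ j : ℕ, ⋃ i : ℕ, ⋃ _ : j ≤ i, ⋃ x ∈ A i, Metric.ball x (ε i ^ α)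

/-- Exponential decay: `limsup log (ε j) / j < 0`. The limit superior is taken in the extended
reals, so that the value `-∞` is allowed. -/
def HasExponentialDecay (ε : ℕ → ℝ) : Prop :=
  limsup (fun j : ℕ => ((Real.log (ε j) / (j : ℝ) : ℝ) : EReal)) atTop < 0

/-!
The heart of the matter is a lower bound in small balls: if `α * s < d`, then the Hausdorff content
`ℋˢ_∞` of `F ∩ B(x, r)` is at least a constant times `r ^ s`, where `F` is the set of approximable
points (`IsRegularUpTo.exists_le_hausdorffContent_approximablePoints`). It comes from a Cantor
construction. A measure `ν` with `ν (B(e, t)) ≤ M t ^ s` and bounded density with respect to `μ` is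
spread out, each part of it moving by a distance of order `ε i`, over the balls of radius
`ε i ^ α / 2` around the points of `A i`. At scales much larger than `ε i` this changes the constant
`M` by a factor close to `1`. At smaller scales the mass in a ball is of order `ε i ^ d`, because of
the bounded density, and `ε i ^ d` is negligible against `(ε i ^ α) ^ s`
(`IsFrostmanStage.exists_next`). Iteration along a sequence of constants bounded by `2 M` gives
nested compact sets with intersection in `F`. A countable covering of this intersection by open
balls covers one of the nested sets, and thus carries the whole mass of the corresponding measure
(`le_mul_hausdorffContent_iInter`); no limit measure is needed.

Small balls are enough for all open sets, since an open set can be exhausted by disjoint small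
pieces: Vitali balls for the Hausdorff content
(`exists_mul_hausdorffContent_le_of_small_balls`), maximal cubes of high level for the net content
(`DyadicDecomposition.exists_mul_netContent_le_of_small_balls`). Given a covering of `F ∩ U`, a
piece is either covered by a bounded enlargement of a single member, or the members that it meets
lie inside it; in the second case the lower bound charges the size of the piece to these members,
and each member is charged once. Hence no regularity of `μ` at scales comparable to the diameter of
`X` is involved, and neither is any relation between the two contents of large sets.

The lower bound `d / α ≤ dimH F` holds because the Hausdorff content is at most the Hausdorff
measure. The upper bound under exponential decay uses the covering of `F` by the balls
`B(y, ε i ^ α)` themselves: at most a constant times `ε i ^ (-d)` of them are needed in a small ball,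
and `∑ ε i ^ (α * t - d)` converges for `t > d / α`.
-/

/-! ### Measures that are Ahlfors regular at small scales -/

/-- The bounds of Ahlfors regularity at the scales `0 < r ≤ R` only, with a fixed constant `C`. -/
structure IsRegularUpTo {X : Type*} [MetricSpace X] [MeasurableSpace X]
    (μ : Measure X) (d C R : ℝ) : Prop where
  d_pos : 0 < d
  C_pos : 0 < C
  R_pos : 0 < R
  le_measure_ball : ∀ (x : X) (r : ℝ), 0 < r → r ≤ R →
    ENNReal.ofReal (C⁻¹ * r ^ d) ≤ μ (Metric.ball x r)
  measure_ball_le : ∀ (x : X) (r : ℝ), 0 < r → r ≤ R →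
    μ (Metric.ball x r) ≤ ENNReal.ofReal (C * r ^ d)

section

variable {X : Type*} [MetricSpace X] [MeasurableSpace X] {μ : Measure X} {d C R : ℝ}

theorem IsAhlforsRegular.exists_isRegularUpTo [Nontrivial X] (h : IsAhlforsRegular μ d) :
    ∃ C R : ℝ, IsRegularUpTo μ d C R := by
  obtain ⟨hd, C, hC, h⟩ := h
  obtain ⟨x, y, hxy⟩ := exists_pair_ne X
  have key : ∀ r : ℝ, r ≤ dist x y → ENNReal.ofReal r ≤ Metric.ediam (univ : Set X) := by
    intro r hr
    refine le_trans ?_ (Metric.edist_le_ediam_of_mem (mem_univ x) (mem_univ y))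
    rw [edist_dist]
    exact ENNReal.ofReal_le_ofReal hr
  exact ⟨C, dist x y, hd, hC, dist_pos.2 hxy, fun z r h0 hr => (h z r h0 (key r hr)).1,
    fun z r h0 hr => (h z r h0 (key r hr)).2⟩

namespace IsRegularUpTo

theorem le_measure_closedBall (h : IsRegularUpTo μ d C R) (x : X) {r : ℝ} (h0 : 0 < r)
    (hr : r ≤ R) : ENNReal.ofReal (C⁻¹ * r ^ d) ≤ μ (Metric.closedBall x r) :=
  (h.le_measure_ball x r h0 hr).trans (measure_mono Metric.ball_subset_closedBall)

theorem measure_closedBall_le (h : IsRegularUpTo μ d C R) (x : X) {r : ℝ} (h0 : 0 < r)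
    (hr : 2 * r ≤ R) : μ (Metric.closedBall x r) ≤ ENNReal.ofReal (C * (2 * r) ^ d) :=
  (measure_mono (Metric.closedBall_subset_ball (by linarith))).trans
    (h.measure_ball_le x (2 * r) (by linarith) hr)

theorem measure_closedBall_pos (h : IsRegularUpTo μ d C R) (x : X) {r : ℝ} (h0 : 0 < r)
    (hr : r ≤ R) : 0 < μ (Metric.closedBall x r) :=
  lt_of_lt_of_le (ENNReal.ofReal_pos.2 (mul_pos (inv_pos.2 h.C_pos) (Real.rpow_pos_of_pos h0 d)))
    (h.le_measure_closedBall x h0 hr)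

theorem one_le_C [Nonempty X] (h : IsRegularUpTo μ d C R) : 1 ≤ C := by
  obtain ⟨x⟩ := ‹Nonempty X›
  have h1 := (h.le_measure_ball x R h.R_pos le_rfl).trans (h.measure_ball_le x R h.R_pos le_rfl)
  have hR := Real.rpow_pos_of_pos h.R_pos d
  have hC := h.C_pos
  rw [ENNReal.ofReal_le_ofReal_iff (by positivity)] at h1
  have h2 := le_of_mul_le_mul_right h1 hR
  by_contra! h3
  have := one_lt_inv_iff₀.2 ⟨hC, h3⟩
  linarith

/-- Small closed balls are totally bounded, because their points at mutual distance `ε` carry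
disjoint balls of measure bounded below; in a complete space they are therefore compact. -/
theorem isCompact_closedBall [OpensMeasurableSpace X] [CompleteSpace X]
    (h : IsRegularUpTo μ d C R) (x : X) {r : ℝ} (hr : 4 * r ≤ R) :
    IsCompact (Metric.closedBall x r) := by
  rcases lt_or_ge r 0 with h0 | h0
  · rw [Metric.closedBall_eq_empty.2 h0]; exact isCompact_empty
  have hR := h.R_pos
  refine isCompact_iff_totallyBounded_isComplete.2
    ⟨?_, (Metric.isClosed_closedBall (x := x) (ε := r)).isComplete⟩
  rw [Metric.totallyBounded_iff]
  intro ε hε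
  set η := min (ε / 5) (R / 4) with hη
  have hη0 : 0 < η := lt_min (by linarith) (by linarith)
  have hη1 : η ≤ ε / 5 := min_le_left _ _
  have hη2 : η ≤ R / 4 := min_le_right _ _
  obtain ⟨u, hut, hdisj, hcov⟩ := Vitali.exists_disjoint_subfamily_covering_enlargement_closedBall
    (Metric.closedBall x r) id (fun _ => η) η (fun _ _ => le_rfl) 4 (by norm_num)
  refine ⟨u, ?_, fun y hy => ?_⟩
  · have hfin := Measure.finite_const_le_meas_of_disjoint_iUnion μ
      (ε := ENNReal.ofReal (C⁻¹ * η ^ d))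
      (ENNReal.ofReal_pos.2 (mul_pos (inv_pos.2 h.C_pos) (Real.rpow_pos_of_pos hη0 d)))
      (As := fun y : u => Metric.closedBall (y : X) η)
      (fun _ => Metric.isClosed_closedBall.measurableSet)
      (fun a b hab => hdisj a.2 b.2 (fun e => hab (Subtype.ext e))) ?_
    · have huniv : {i : u | ENNReal.ofReal (C⁻¹ * η ^ d) ≤ μ (Metric.closedBall (i : X) η)}
          = univ := by
        ext y
        simpa using h.le_measure_closedBall (y : X) hη0 (by linarith)
      rw [huniv, Set.finite_univ_iff] at hfin
      exact Set.toFinite u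
    · refine ne_top_of_le_ne_top ENNReal.ofReal_ne_top
        (le_trans (measure_mono ?_) (h.measure_ball_le x R hR le_rfl))
      refine iUnion_subset fun y z hz => ?_
      have h1 := Metric.mem_closedBall.1 (hut y.2)
      have h2 := Metric.mem_closedBall.1 hz
      rw [Metric.mem_ball]
      have := dist_triangle z (y : X) x
      linarith
  · obtain ⟨b, hb, hyb⟩ := hcov y hy
    refine mem_iUnion₂.2 ⟨b, hb, ?_⟩
    have := Metric.mem_closedBall.1 (hyb (Metric.mem_closedBall_self hη0.le))
    rw [Metric.mem_ball]
    simp only [id] at this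
    linarith

end IsRegularUpTo

/-! ### Redistributing a measure onto small balls -/

theorem exists_disjoint_cells {α : Type*} [MeasurableSpace α] (T : Finset α) {B : α → Set α}
    (hB : ∀ y, MeasurableSet (B y)) :
    ∃ D : α → Set α, (∀ y, MeasurableSet (D y)) ∧ (∀ y, D y ⊆ B y) ∧
      (T : Set α).PairwiseDisjoint D ∧ ⋃ y ∈ T, D y = ⋃ y ∈ T, B y := by
  classical
  induction T using Finset.induction_on with
  | empty => exact ⟨B, hB, fun _ => Subset.rfl, by simp, rfl⟩
  | insert a T ha ih =>
    obtain ⟨D, hD, hDB, hdisj, hU⟩ := ih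
    have hne : ∀ y ∈ T, y ≠ a := fun y hy e => ha (e ▸ hy)
    refine ⟨Function.update D a (B a \ ⋃ y ∈ T, D y), fun y => ?_, fun y => ?_, ?_, ?_⟩
    · rcases eq_or_ne y a with rfl | h
      · simpa using (hB y).diff (T.measurableSet_biUnion fun z _ => hD z)
      · simpa [h] using hD y
    · rcases eq_or_ne y a with rfl | h
      · simp
      · simpa [h] using hDB y
    · rw [Finset.coe_insert, Set.pairwiseDisjoint_insert_of_notMem (by simpa using ha)]
      constructor
      · intro y hy z hz hyz
        have h1 := hne y hy
        have h2 := hne z hz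
        simpa [Function.onFun, h1, h2] using hdisj hy hz hyz
      · intro y hy
        simp only [Function.update_self, Function.update_of_ne (hne y hy)]
        exact disjoint_sdiff_left.mono_right 
          (subset_biUnion_of_mem (s := (T : Set α)) (u := D) hy)
    · rw [Finset.set_biUnion_insert, Finset.set_biUnion_insert, Function.update_self, ← hU]
      have : ⋃ y ∈ T, Function.update D a (B a \ ⋃ y ∈ T, D y) y = ⋃ y ∈ T, D y :=
        iUnion₂_congr fun y hy => by rw [Function.update_of_ne (hne y hy)]
      rw [this, sdiff_union_self]

/-- Redistribution of a measure `ν`, carried by a compact set `S`, onto balls of radius `b` centred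
at points of an `a`-dense set `A`: the part of `ν` in a cell within distance `a` of a point of `A`
is spread over the ball around that point, in proportion to `μ`. If no such ball has more than the
fraction `θ` of its measure in a given ball, the new mass of the latter is at most `θ` times the old
mass of the concentric ball whose radius is larger by `a + b`. -/
theorem exists_redistribution [OpensMeasurableSpace X] {ν : Measure X} {S A : Set X} {a b : ℝ}
    (hS : IsCompact S) (hνS : ν Sᶜ = 0) (hν : ν univ ≠ ⊤)
    (hA : ∀ x, ∃ y ∈ A, dist x y < a)
    (hpos : ∀ y, μ (Metric.closedBall y b) ≠ 0) (hfin : ∀ y, μ (Metric.closedBall y b) ≠ ⊤) :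
    ∃ (S' : Set X) (ν' : Measure X), IsClosed S' ∧ ν' S'ᶜ = 0 ∧ ν' univ = ν univ ∧
      (∀ z ∈ S', ∃ y ∈ A, dist z y ≤ b ∧ ∃ x ∈ S, dist x y < a) ∧
      (∃ L : ENNReal, L ≠ ⊤ ∧ ν' ≤ L • μ) ∧
      ∀ (e : X) (t : ℝ) (θ : ENNReal),
        (∀ y, μ (Metric.closedBall y b ∩ Metric.closedBall e t) ≤
          θ * μ (Metric.closedBall y b)) →
        ν' (Metric.closedBall e t) ≤ θ * ν (Metric.closedBall e (t + b + a)) := by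
  classical
  obtain ⟨T, hTA, hTfin, hST⟩ := hS.elim_finite_subcover_image
    (b := {y ∈ A | ∃ x ∈ S, dist x y < a}) (c := fun y => Metric.ball y a)
    (fun _ _ => Metric.isOpen_ball) (fun x hx => by
      obtain ⟨y, hy, hxy⟩ := hA x
      exact mem_iUnion₂.2 ⟨y, ⟨hy, x, hx, hxy⟩, hxy⟩)
  lift T to Finset X using hTfin
  obtain ⟨D, hDm, hDB, hDdisj, hDU⟩ := exists_disjoint_cells T (B := fun y => Metric.ball y a)
    (fun y => Metric.isOpen_ball.measurableSet)
  set ν' : Measure X :=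
    ∑ y ∈ T, (ν (D y) / μ (Metric.closedBall y b)) • μ.restrict (Metric.closedBall y b) with hν'
  have happ : ∀ E, MeasurableSet E → ν' E =
      ∑ y ∈ T, ν (D y) / μ (Metric.closedBall y b) * μ (Metric.closedBall y b ∩ E) := by
    intro E hE
    simp only [hν', Measure.finsetSum_apply, Measure.smul_apply, smul_eq_mul,
      Measure.restrict_apply hE]
    exact Finset.sum_congr rfl fun y _ => by rw [inter_comm]
  have hcells : ∑ y ∈ T, ν (D y) = ν univ := by
    rw [← measure_biUnion_finset hDdisj (fun y _ => hDm y), hDU]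
    refine le_antisymm (measure_mono (subset_univ _)) ?_
    calc ν univ ≤ ν S + ν Sᶜ := by
          rw [← union_compl_self S]; exact measure_union_le _ _
      _ = ν S := by rw [hνS, add_zero]
      _ ≤ _ := measure_mono hST
  have hS'closed : IsClosed (⋃ y ∈ T, Metric.closedBall y b) :=
    T.finite_toSet.isClosed_biUnion fun _ _ => Metric.isClosed_closedBall
  refine ⟨⋃ y ∈ T, Metric.closedBall y b, ν', hS'closed, ?_, ?_, ?_, ?_, ?_⟩
  · rw [happ _ hS'closed.measurableSet.compl]
    refine Finset.sum_eq_zero fun y hy => ?_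
    have : Metric.closedBall y b ∩ (⋃ y ∈ T, Metric.closedBall y b)ᶜ = ∅ := by
      rw [← Set.sdiff_eq, Set.sdiff_eq_empty]
      exact subset_biUnion_of_mem (u := fun y => Metric.closedBall y b) hy
    rw [this, measure_empty, mul_zero]
  · rw [happ _ MeasurableSet.univ, ← hcells]
    exact Finset.sum_congr rfl fun y _ => by
      rw [inter_univ, ENNReal.div_mul_cancel (hpos y) (hfin y)]
  · intro z hz
    obtain ⟨y, hy, hzy⟩ := mem_iUnion₂.1 hz
    exact ⟨y, (hTA hy).1, hzy, (hTA hy).2⟩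
  · refine ⟨∑ y ∈ T, ν (D y) / μ (Metric.closedBall y b), ?_, ?_⟩
    · refine ENNReal.sum_ne_top.2 fun y _ => ENNReal.div_ne_top ?_ (hpos y)
      exact ne_top_of_le_ne_top hν (measure_mono (subset_univ _))
    · refine Measure.le_iff.2 fun E hE => ?_
      rw [happ E hE, Measure.smul_apply, smul_eq_mul, Finset.sum_mul]
      gcongr
      exact inter_subset_right
  · intro e t θ hθ
    rw [happ _ Metric.isClosed_closedBall.measurableSet]
    set T' := T.filter fun y => (Metric.closedBall y b ∩ Metric.closedBall e t).Nonempty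
    calc ∑ y ∈ T, ν (D y) / μ (Metric.closedBall y b) *
          μ (Metric.closedBall y b ∩ Metric.closedBall e t)
        = ∑ y ∈ T', ν (D y) / μ (Metric.closedBall y b) *
          μ (Metric.closedBall y b ∩ Metric.closedBall e t) := by
          refine (Finset.sum_filter_of_ne fun y _ h => ?_).symm
          by_contra hne
          rw [Set.not_nonempty_iff_eq_empty.1 hne, measure_empty, mul_zero] at h
          exact h rfl
      _ ≤ ∑ y ∈ T', θ * ν (D y) := by
          refine Finset.sum_le_sum fun y _ => ?_
          calc _ ≤ ν (D y) / μ (Metric.closedBall y b) * (θ * μ (Metric.closedBall y b)) := by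
                gcongr; exact hθ y
            _ = θ * (ν (D y) / μ (Metric.closedBall y b) * μ (Metric.closedBall y b)) := by ring
            _ = θ * ν (D y) := by rw [ENNReal.div_mul_cancel (hpos y) (hfin y)]
      _ = θ * ν (⋃ y ∈ T', D y) := by
          rw [← Finset.mul_sum, measure_biUnion_finset
            (hDdisj.subset (Finset.coe_subset.2 (Finset.filter_subset _ _))) (fun y _ => hDm y)]
      _ ≤ θ * ν (Metric.closedBall e (t + b + a)) := by
          gcongr
          refine iUnion₂_subset fun y hy x hx => ?_
          obtain ⟨z, hz1, hz2⟩ := (Finset.mem_filter.1 hy).2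
          have h1 := Metric.mem_ball.1 (hDB y hx)
          have h2 := Metric.mem_closedBall.1 hz1
          have h3 := Metric.mem_closedBall.1 hz2
          rw [Metric.mem_closedBall]
          have h4 := dist_triangle x y e
          have h5 := dist_triangle y z e
          rw [dist_comm y z] at h5
          linarith

end

/-! ### Frostman measures on the stages of a Cantor construction -/

/-- One stage of the construction of a Cantor set inside the approximable points: a measure `ν` of
total mass `m`, carried by the compact set `S`, with bounded density with respect to `μ` and with
`ν (B(e, t)) ≤ M t ^ s` for all closed balls. -/
structure IsFrostmanStage {X : Type*} [MetricSpace X] [MeasurableSpace X]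
    (μ : Measure X) (s M : ℝ) (m : ENNReal) (S : Set X) (ν : Measure X) : Prop where
  isCompact : IsCompact S
  compl_eq_zero : ν Sᶜ = 0
  mass : ν univ = m
  exists_density : ∃ L : ENNReal, L ≠ ⊤ ∧ ν ≤ L • μ
  growth : ∀ (e : X) (t : ℝ), 0 < t → ν (Metric.closedBall e t) ≤ ENNReal.ofReal (M * t ^ s)

section

variable {X : Type*} [MetricSpace X] [MeasurableSpace X] {μ : Measure X} {d C R : ℝ}

/-- The fraction of the measure of a ball of radius `b` that lies in a ball of radius `t`. -/
theorem IsRegularUpTo.measure_inter_closedBall_le (h : IsRegularUpTo μ d C R) {s b t : ℝ}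
    (hsd : s ≤ d) (hb : 0 < b) (hbR : b ≤ R) (ht : 0 < t) (htR : 2 * t ≤ R) (hs : 0 ≤ s)
    (y e : X) :
    μ (Metric.closedBall y b ∩ Metric.closedBall e t) ≤
      ENNReal.ofReal (C ^ 2 * 2 ^ d * (t / b) ^ s) * μ (Metric.closedBall y b) := by
  have hC : 1 ≤ C := haveI : Nonempty X := ⟨y⟩; h.one_le_C
  have hC0 := h.C_pos
  have hd := h.d_pos
  have h2 : (1 : ℝ) ≤ 2 ^ d := Real.one_le_rpow (by norm_num) hd.le
  rcases le_or_gt t b with htb | htb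
  · have hq : (t / b) ^ d ≤ (t / b) ^ s :=
      Real.rpow_le_rpow_of_exponent_ge (by positivity) ((div_le_one hb).2 htb) hsd
    calc _ ≤ μ (Metric.closedBall e t) := measure_mono inter_subset_right
      _ ≤ ENNReal.ofReal (C * (2 * t) ^ d) := h.measure_closedBall_le e ht htR
      _ = ENNReal.ofReal (C ^ 2 * 2 ^ d * (t / b) ^ d) * ENNReal.ofReal (C⁻¹ * b ^ d) := by
          rw [← ENNReal.ofReal_mul (by positivity), Real.div_rpow ht.le hb.le,
            Real.mul_rpow (by norm_num) ht.le]
          congr 1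
          have := Real.rpow_pos_of_pos hb d
          field_simp
      _ ≤ _ := by
          gcongr
          exact h.le_measure_closedBall y hb hbR
  · calc _ ≤ 1 * μ (Metric.closedBall y b) := by
          rw [one_mul]; exact measure_mono inter_subset_left
      _ ≤ _ := by
          gcongr
          rw [ENNReal.one_le_ofReal]
          have h3 : (1 : ℝ) ≤ (t / b) ^ s := Real.one_le_rpow ((one_le_div hb).2 htb.le) hs
          have h4 : 1 ≤ C ^ 2 := one_le_pow₀ hC
          exact one_le_mul_of_one_le_of_one_le (one_le_mul_of_one_le_of_one_le h4 h2) h3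

/-- The inductive step: from a stage carried by `S`, the measure is redistributed onto balls of
radius `ε i ^ α / 2` around points of a net `A i` with `i` large. At scales much larger than `ε i`
the constant `M` gets worse by a factor close to `1`; at smaller scales the bounded density gives
mass at most a constant times `ε i ^ d` per ball of radius comparable to `ε i`, and this is
negligible because `α * s < d`. -/
theorem IsFrostmanStage.exists_next [OpensMeasurableSpace X] (h : IsRegularUpTo μ d C R)
    {s α : ℝ} (hs : 0 < s) (hα : 1 ≤ α) (hsd : α * s < d)
    {ε : ℕ → ℝ} (hε_pos : ∀ j, 0 < ε j) (hε : Tendsto ε atTop (𝓝 0))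
    {C₁ : ℝ} (hC₁ : 0 < C₁) {A : ℕ → Set X} (hA : ∀ j x, ∃ y ∈ A j, dist x y < C₁ * ε j)
    {M M' : ℝ} (hM : 0 < M) (hMM' : M < M') {m : ENNReal} (hm : m ≠ ⊤) {S O : Set X}
    {ν : Measure X} (hν : IsFrostmanStage μ s M m S ν) (hO : IsOpen O) (hSO : S ⊆ O)
    (hOc : ∃ Z, IsCompact Z ∧ O ⊆ Z) (j : ℕ) :
    ∃ (S' : Set X) (ν' : Measure X), IsFrostmanStage μ s M' m S' ν' ∧ S' ⊆ O ∧
      S' ⊆ ⋃ i : ℕ, ⋃ _ : j ≤ i, ⋃ x ∈ A i, Metric.ball x (ε i ^ α) := by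
  obtain ⟨L, hL, hνL⟩ := hν.exists_density
  have hC0 := h.C_pos
  have hd := h.d_pos
  have hR := h.R_pos
  obtain ⟨τ, hτ, hτO⟩ := hν.isCompact.exists_thickening_subset_open hO hSO
  -- a relative enlargement `1 + u` of the radius that changes `M` to at most `M'`
  obtain ⟨u, hu, huM⟩ : ∃ u : ℝ, 0 < u ∧ M * (1 + u) ^ s ≤ M' := by
    have hc : Tendsto (fun u : ℝ => M * (1 + u) ^ s) (𝓝[>] 0) (𝓝 (M * (1 + 0) ^ s)) := by
      refine Tendsto.mono_left ?_ nhdsWithin_le_nhds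
      refine ContinuousAt.tendsto ?_
      exact continuousAt_const.mul
        ((continuousAt_const.add continuousAt_id).rpow_const (Or.inr hs.le))
    have hlt : M * (1 + 0) ^ s < M' := by simpa using hMM'
    obtain ⟨u, hu, hu0⟩ := ((hc.eventually (gt_mem_nhds hlt)).and self_mem_nhdsWithin).exists
    exact ⟨u, hu0, hu.le⟩
  set B : ℝ := (1 + C₁) * (1 + 1 / u) with hB
  have hB0 : 0 < B := by positivity
  have hB1 : 1 + C₁ ≤ B := le_mul_of_one_le_right (by positivity)
    (by have : 0 < 1 / u := by positivity
        linarith)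
  set Q : ℝ := C ^ 2 * 2 ^ d * 2 ^ s * (L.toReal * (C * (2 * B) ^ d)) with hQ
  have hev : ∀ᶠ i in atTop, ((1 + C₁) * ε i < τ ∧ 2 * (B * ε i) < R) ∧
      (ε i < 1 ∧ Q * ε i ^ (d - α * s) < M') := by
    have hlim : ∀ c : ℝ, Tendsto (fun i => c * ε i) atTop (𝓝 0) := fun c => by
      simpa using hε.const_mul c
    refine ((((hlim (1 + C₁)).eventually (gt_mem_nhds hτ))).and
      ?_).and ((hε.eventually (gt_mem_nhds one_pos)).and ?_)
    · simpa [mul_assoc] using (hlim (2 * B)).eventually (gt_mem_nhds hR)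
    · have h1 : Tendsto (fun i => Q * ε i ^ (d - α * s)) atTop (𝓝 0) := by
        have h2 := (hε.rpow_const (p := d - α * s) (Or.inr (by linarith))).const_mul Q
        rwa [Real.zero_rpow (by linarith), mul_zero] at h2
      exact h1.eventually (gt_mem_nhds (hM.trans hMM'))
  obtain ⟨i, ⟨⟨hi1, hi2⟩, hi3, hi4⟩, hij⟩ := (hev.and (eventually_ge_atTop j)).exists
  set η := ε i with hη
  have hη0 : 0 < η := hε_pos i
  set b := η ^ α / 2 with hb
  have hρ0 : 0 < η ^ α := Real.rpow_pos_of_pos hη0 α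
  have hb0 : 0 < b := by positivity
  have hbη : b ≤ η := by
    have : η ^ α ≤ η ^ (1 : ℝ) := Real.rpow_le_rpow_of_exponent_ge hη0 hi3.le hα
    rw [Real.rpow_one] at this
    linarith
  have hηB : (1 + C₁) * η ≤ B * η := by gcongr
  have hC₁η : 0 < C₁ * η := by positivity
  have hbR : 2 * b ≤ R := by nlinarith
  obtain ⟨S', ν', hS'c, hS'0, hmass, hS', hdens, hgrow⟩ :=
    exists_redistribution (μ := μ) (ν := ν) (A := A i) (a := C₁ * η) (b := b) hν.isCompact
      hν.compl_eq_zero (by rw [hν.mass]; exact hm) (hA i)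
      (fun y => (h.measure_closedBall_pos y hb0 (by linarith)).ne')
      (fun y => ne_top_of_le_ne_top ENNReal.ofReal_ne_top (h.measure_closedBall_le y hb0 hbR))
  have hS'O : S' ⊆ O := by
    intro z hz
    obtain ⟨y, _, hzy, x, hx, hxy⟩ := hS' z hz
    refine hτO (Metric.mem_thickening_iff.2 ⟨x, hx, ?_⟩)
    have := dist_triangle z y x
    rw [dist_comm y x] at this
    linarith
  refine ⟨S', ν', ⟨?_, hS'0, hmass.trans hν.mass, hdens, fun e t ht => ?_⟩, hS'O, ?_⟩
  · obtain ⟨Z, hZ, hOZ⟩ := hOc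
    exact hZ.of_isClosed_subset hS'c (hS'O.trans hOZ)
  · rcases le_or_gt ((1 + C₁) * η) (u * t) with hcase | hcase
    · calc ν' (Metric.closedBall e t)
          ≤ 1 * ν (Metric.closedBall e (t + b + C₁ * η)) :=
            hgrow e t 1 fun y => by rw [one_mul]; exact measure_mono inter_subset_left
        _ ≤ ν (Metric.closedBall e ((1 + u) * t)) := by
            rw [one_mul]
            exact measure_mono (Metric.closedBall_subset_closedBall (by linarith))
        _ ≤ ENNReal.ofReal (M * ((1 + u) * t) ^ s) := hν.growth e _ (by positivity)
        _ ≤ ENNReal.ofReal (M' * t ^ s) := by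
            refine ENNReal.ofReal_le_ofReal ?_
            rw [Real.mul_rpow (by positivity) ht.le, ← mul_assoc]
            gcongr
    · have ht2 : t + b + C₁ * η ≤ B * η := by
        have h1 : t ≤ (1 + C₁) * η / u := by
          rw [le_div_iff₀ hu]; linarith
        have h2 : B * η = (1 + C₁) * η + (1 + C₁) * η / u := by rw [hB]; ring
        linarith
      calc ν' (Metric.closedBall e t)
          ≤ ENNReal.ofReal (C ^ 2 * 2 ^ d * (t / b) ^ s) *
            ν (Metric.closedBall e (t + b + C₁ * η)) :=
            hgrow e t _ fun y => h.measure_inter_closedBall_le (by nlinarith) hb0 (by linarith) ht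
              (by linarith) hs.le y e
        _ ≤ ENNReal.ofReal (C ^ 2 * 2 ^ d * (t / b) ^ s) *
            (ENNReal.ofReal L.toReal * ENNReal.ofReal (C * (2 * (B * η)) ^ d)) := by
            gcongr
            calc _ ≤ ν (Metric.closedBall e (B * η)) :=
                  measure_mono (Metric.closedBall_subset_closedBall ht2)
              _ ≤ L * μ (Metric.closedBall e (B * η)) := hνL _
              _ ≤ _ := by
                rw [ENNReal.ofReal_toReal hL]
                gcongr
                exact h.measure_closedBall_le e (by positivity) hi2.le
        _ = ENNReal.ofReal (Q * η ^ (d - α * s) * t ^ s) := by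
            rw [← ENNReal.ofReal_mul ENNReal.toReal_nonneg, ← ENNReal.ofReal_mul (by positivity)]
            congr 1
            rw [hQ, hb, Real.div_rpow ht.le (by positivity), Real.div_rpow hρ0.le (by norm_num),
              ← mul_assoc 2 B η, Real.mul_rpow (by positivity) hη0.le, Real.rpow_sub hη0,
              Real.rpow_mul hη0.le]
            have h1 : 0 < (η ^ α) ^ s := Real.rpow_pos_of_pos hρ0 s
            field_simp
        _ ≤ ENNReal.ofReal (M' * t ^ s) := by
            gcongr
  · intro z hz
    obtain ⟨y, hy, hzy, -⟩ := hS' z hz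
    simp only [mem_iUnion]
    exact ⟨i, hij, y, hy, Metric.mem_ball.2 (by linarith)⟩

/-- The restriction of `μ` to a small ball starts the construction. -/
theorem IsRegularUpTo.isFrostmanStage_restrict [OpensMeasurableSpace X] [CompleteSpace X]
    (h : IsRegularUpTo μ d C R) {s r : ℝ} (hs : 0 < s) (hsd : s ≤ d) (hr : 0 < r)
    (hrR : 4 * r ≤ R) (x : X) :
    IsFrostmanStage μ s (C * 2 ^ d * r ^ (d - s)) (μ (Metric.closedBall x (r / 2)))
      (Metric.closedBall x (r / 2)) (μ.restrict (Metric.closedBall x (r / 2))) where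
  isCompact := h.isCompact_closedBall x (by linarith)
  compl_eq_zero := by
    rw [Measure.restrict_apply Metric.isClosed_closedBall.measurableSet.compl, compl_inter_self,
      measure_empty]
  mass := Measure.restrict_apply_univ _
  exists_density := ⟨1, ENNReal.one_ne_top, by rw [one_smul]; exact Measure.restrict_le_self⟩
  growth e t ht := by
    have hC0 := h.C_pos
    have hd := h.d_pos
    have key : ∀ ρ : ℝ, 0 < ρ → ρ ≤ r → ρ ≤ t →
        C * (2 * ρ) ^ d ≤ C * 2 ^ d * r ^ (d - s) * t ^ s := fun ρ h0 h1 h2 => by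
      rw [Real.mul_rpow (by norm_num) h0.le, mul_assoc, mul_assoc]
      have : ρ ^ d = ρ ^ (d - s) * ρ ^ s := by rw [← Real.rpow_add h0]; ring_nf
      rw [this]
      gcongr
    rw [Measure.restrict_apply Metric.isClosed_closedBall.measurableSet]
    rcases le_or_gt t r with htr | htr
    · exact ((measure_mono inter_subset_left).trans
        (h.measure_closedBall_le e ht (by linarith))).trans
        (ENNReal.ofReal_le_ofReal (key t ht htr le_rfl))
    · refine ((measure_mono (inter_subset_right.trans
        (Metric.closedBall_subset_closedBall (by linarith)))).trans
        (h.measure_closedBall_le x hr (by linarith))).trans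
        (ENNReal.ofReal_le_ofReal (key r hr le_rfl htr.le))

end

/-! ### Hausdorff content of the approximable points in small balls -/

theorem exists_seq_of_forall_exists_succ {β : Type*} {P : ℕ → β → Prop} {r : ℕ → β → β → Prop}
    {b : β} (h0 : P 0 b) (h : ∀ k x, P k x → ∃ y, P (k + 1) y ∧ r k x y) :
    ∃ f : ℕ → β, f 0 = b ∧ ∀ k, P k (f k) ∧ r k (f k) (f (k + 1)) := by
  choose! g hg using h
  let f : ℕ → β := fun n => Nat.rec b (fun k x => g k x) n
  have hP : ∀ k, P k (f k) := fun k => by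
    induction k with
    | zero => exact h0
    | succ k ih => exact (hg k _ ih).1
  exact ⟨f, rfl, fun k => ⟨hP k, (hg k _ (hP k)).2⟩⟩

theorem exists_radius_gt {s : ℝ} (hs : 0 < s) {D κ : ENNReal} (hD : D ≠ ⊤) (hκ : 0 < κ) :
    ∃ r : ℝ, 0 < r ∧ D < ENNReal.ofReal r ∧ ENNReal.ofReal (r ^ s) ≤ D ^ s + κ := by
  have hc : Tendsto (fun r : ℝ => ENNReal.ofReal (r ^ s)) (𝓝[>] D.toReal)
      (𝓝 (ENNReal.ofReal (D.toReal ^ s))) := by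
    refine Tendsto.mono_left ?_ nhdsWithin_le_nhds
    exact ENNReal.tendsto_ofReal (Real.continuousAt_rpow_const _ _ (Or.inr hs.le)).tendsto
  have hD' : ENNReal.ofReal (D.toReal ^ s) = D ^ s := by
    rw [← ENNReal.ofReal_rpow_of_nonneg ENNReal.toReal_nonneg hs.le, ENNReal.ofReal_toReal hD]
  rw [hD'] at hc
  have hlt : D ^ s < D ^ s + κ :=
    ENNReal.lt_add_right (ENNReal.rpow_ne_top_of_nonneg hs.le hD) hκ.ne'
  obtain ⟨r, hr, hr0⟩ := ((hc.eventually (gt_mem_nhds hlt)).and self_mem_nhdsWithin).exists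
  have hr0 : D.toReal < r := hr0
  exact ⟨r, ENNReal.toReal_nonneg.trans_lt hr0,
    (ENNReal.lt_ofReal_iff_toReal_lt hD).2 hr0, hr.le⟩

section

variable {X : Type*} [MetricSpace X]

theorem hausdorffContent_mono (s : ℝ) {E F : Set X} (h : E ⊆ F) :
    hausdorffContent s E ≤ hausdorffContent s F :=
  le_iInf₂ fun t ht => iInf₂_le t (h.trans ht)

theorem hausdorffContent_le_tsum {s : ℝ} (hs : 0 < s) {ι : Type*} [Countable ι] (t : ι → Set X)
    {E : Set X} (h : E ⊆ ⋃ i, t i) : hausdorffContent s E ≤ ∑' i, Metric.ediam (t i) ^ s := by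
  obtain ⟨f, hf⟩ := exists_injective_nat ι
  refine (iInf₂_le (Function.extend f t fun _ => ∅) fun x hx => ?_).trans (le_of_eq ?_)
  · obtain ⟨i, hi⟩ := mem_iUnion.1 (h hx)
    exact mem_iUnion.2 ⟨f i, by rwa [hf.extend_apply]⟩
  · rw [← hf.tsum_eq (f := fun n => Metric.ediam (Function.extend f t (fun _ => ∅) n) ^ s)]
    · simp [hf.extend_apply]
    · intro n hn
      by_contra hn'
      rw [Function.mem_support, Function.extend_apply' _ _ _ (by simpa using hn'),
        Metric.ediam_empty, ENNReal.zero_rpow_of_pos hs] at hn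
      exact hn rfl

/-- The mass distribution principle along a decreasing sequence of compact sets `Z k`: no limit
measure is needed, because a covering of the intersection by open balls already covers one of
the `Z k`. -/
theorem le_mul_hausdorffContent_iInter [MeasurableSpace X] {s M : ℝ} (hs : 0 < s) (hM : 0 < M)
    {m : ENNReal} {Z : ℕ → Set X} (hZ : ∀ k, IsCompact (Z k)) (hanti : Antitone Z)
    {ν : ℕ → Measure X} (hZν : ∀ k, m ≤ ν k (Z k))
    (hgrow : ∀ k (e : X) (t : ℝ), 0 < t → ν k (Metric.closedBall e t) ≤ ENNReal.ofReal (M * t ^ s)) :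
    m ≤ ENNReal.ofReal M * hausdorffContent s (⋂ k, Z k) := by
  have hM' : ENNReal.ofReal M ≠ 0 := (ENNReal.ofReal_pos.2 hM).ne'
  rw [hausdorffContent, ENNReal.mul_iInf_of_ne hM' ENNReal.ofReal_ne_top]
  refine le_iInf fun t => ?_
  rw [ENNReal.mul_iInf_of_ne hM' ENNReal.ofReal_ne_top]
  refine le_iInf fun ht => ?_
  by_cases hfin : ∀ n, Metric.ediam (t n) ≠ ⊤
  swap
  · push Not at hfin
    obtain ⟨n, hn⟩ := hfin
    have : ∑' n, Metric.ediam (t n) ^ s = ⊤ := by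
      refine top_unique (le_trans ?_ (ENNReal.le_tsum n))
      rw [hn, ENNReal.top_rpow_of_pos hs]
    rw [this, ENNReal.mul_top hM']
    exact le_top
  have key : ∀ κ : ENNReal, κ ≠ 0 →
      m ≤ ENNReal.ofReal M * (∑' n, Metric.ediam (t n) ^ s + κ) := by
    intro κ hκ
    obtain ⟨κ', hκ'0, hκ'⟩ := ENNReal.exists_pos_sum_of_countable' hκ ℕ
    choose r hr0 hr1 hr2 using fun n => exists_radius_gt hs (hfin n) (hκ'0 n)
    have hball : ∀ n, ∃ W : Set X, IsOpen W ∧ t n ⊆ W ∧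
        ∀ k, ν k W ≤ ENNReal.ofReal (M * r n ^ s) := fun n => by
      rcases (t n).eq_empty_or_nonempty with he | ⟨e, he⟩
      · exact ⟨∅, isOpen_empty, he.subset, fun k => by simp⟩
      · refine ⟨Metric.ball e (r n), Metric.isOpen_ball, fun x hx => ?_, fun k =>
          (measure_mono Metric.ball_subset_closedBall).trans (hgrow k e _ (hr0 n))⟩
        have := (Metric.edist_le_ediam_of_mem hx he).trans_lt (hr1 n)
        rwa [edist_dist, ENNReal.ofReal_lt_ofReal_iff (hr0 n)] at this
    choose W hWo hWt hWν using hball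
    have hKW : ⋂ k, Z k ⊆ ⋃ n, W n := ht.trans (iUnion_mono hWt)
    obtain ⟨k, hk⟩ := exists_subset_nhds_of_isCompact (directed_of_isDirected_le hanti) hZ
      (fun x hx => (isOpen_iUnion hWo).mem_nhds (hKW hx))
    calc m ≤ ν k (⋃ n, W n) := (hZν k).trans (measure_mono hk)
      _ ≤ ∑' n, ν k (W n) := measure_iUnion_le _
      _ ≤ ∑' n, ENNReal.ofReal M * (Metric.ediam (t n) ^ s + κ' n) := by
          refine ENNReal.tsum_le_tsum fun n => (hWν n k).trans ?_
          rw [ENNReal.ofReal_mul hM.le]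
          gcongr
          exact hr2 n
      _ = ENNReal.ofReal M * (∑' n, Metric.ediam (t n) ^ s + ∑' n, κ' n) := by
          rw [ENNReal.tsum_mul_left, ENNReal.tsum_add]
      _ ≤ _ := by gcongr
  have hlim : Tendsto (fun κ : ENNReal => ENNReal.ofReal M * (∑' n, Metric.ediam (t n) ^ s + κ))
      (𝓝[≠] 0) (𝓝 (ENNReal.ofReal M * (∑' n, Metric.ediam (t n) ^ s + 0))) :=
    Tendsto.mono_left (ENNReal.Tendsto.const_mul (tendsto_const_nhds.add tendsto_id)
      (Or.inr ENNReal.ofReal_ne_top)) nhdsWithin_le_nhds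
  rw [add_zero] at hlim
  exact ge_of_tendsto hlim (eventually_nhdsWithin_of_forall fun κ hκ => key κ hκ)

variable [MeasurableSpace X] {μ : Measure X} {d C R : ℝ}

/-- Small balls meet the set of approximable points in a set of Hausdorff content comparable to
that of the ball. -/
theorem IsRegularUpTo.exists_le_hausdorffContent_approximablePoints [OpensMeasurableSpace X]
    [CompleteSpace X] (h : IsRegularUpTo μ d C R)
    {s α : ℝ} (hs : 0 < s) (hα : 1 ≤ α) (hsd : α * s < d)
    {ε : ℕ → ℝ} (hε_pos : ∀ j, 0 < ε j) (hε : Tendsto ε atTop (𝓝 0))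
    {C₁ : ℝ} (hC₁ : 0 < C₁) {A : ℕ → Set X} (hA : ∀ j x, ∃ y ∈ A j, dist x y < C₁ * ε j) :
    ∃ c : ℝ, 0 < c ∧ ∀ (x : X) (r : ℝ), 0 < r → 4 * r ≤ R →
      ENNReal.ofReal (c * r ^ s) ≤
        hausdorffContent s (approximablePoints ε α A ∩ Metric.ball x r) := by
  have hC0 := h.C_pos
  have hd := h.d_pos
  have hsd' : s ≤ d := by nlinarith
  refine ⟨(2 * (C ^ 2 * 4 ^ d))⁻¹, by positivity, fun x r hr hrR => ?_⟩
  set Ω : ℕ → Set X := fun j => ⋃ i : ℕ, ⋃ _ : j ≤ i, ⋃ x ∈ A i, Metric.ball x (ε i ^ α) with hΩ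
  have hΩo : ∀ j, IsOpen (Ω j) := fun j => isOpen_iUnion fun i => isOpen_iUnion fun _ =>
    isOpen_biUnion fun _ _ => Metric.isOpen_ball
  set M := C * 2 ^ d * r ^ (d - s) with hM
  have hM0 : 0 < M := by positivity
  set m := μ (Metric.closedBall x (r / 2)) with hm
  have hm_top : m ≠ ⊤ :=
    ne_top_of_le_ne_top ENNReal.ofReal_ne_top (h.measure_closedBall_le x (by linarith) (by linarith))
  set Mk : ℕ → ℝ := fun k => M * (2 - (1 / 2) ^ k) with hMk
  have hMk0 : ∀ k, 0 < Mk k := fun k => by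
    have : ((1 : ℝ) / 2) ^ k ≤ 1 := pow_le_one₀ (by norm_num) (by norm_num)
    exact mul_pos hM0 (by linarith)
  have hMk_lt : ∀ k, Mk k < Mk (k + 1) := fun k => by
    have h1 : (0 : ℝ) < (1 / 2) ^ k := by positivity
    have h2 : ((1 : ℝ) / 2) ^ (k + 1) = (1 / 2) ^ k / 2 := by rw [pow_succ]; ring
    exact mul_lt_mul_of_pos_left (by rw [h2]; linarith) hM0
  have hMk_le : ∀ k, Mk k ≤ 2 * M := fun k => by
    have h1 : (0 : ℝ) < (1 / 2) ^ k := by positivity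
    have : Mk k = 2 * M - M * (1 / 2) ^ k := by simp only [hMk]; ring
    rw [this]
    have := mul_pos hM0 h1
    linarith
  -- the state consists of an open set, the support inside it, and the measure
  obtain ⟨f, hf0, hf⟩ := exists_seq_of_forall_exists_succ
    (P := fun k (p : Set X × Set X × Measure X) => IsOpen p.1 ∧ p.1 ⊆ Metric.ball x r ∧ p.2.1 ⊆ p.1 ∧
      IsFrostmanStage μ s (Mk k) m p.2.1 p.2.2)
    (r := fun k p q => closure q.1 ⊆ p.1 ∩ Ω k)
    (b := (Metric.ball x r, Metric.closedBall x (r / 2),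
      μ.restrict (Metric.closedBall x (r / 2))))
    ⟨Metric.isOpen_ball, Subset.rfl, Metric.closedBall_subset_ball (by linarith), by
      have : Mk 0 = M := by simp only [hMk]; norm_num
      rw [this]
      exact h.isFrostmanStage_restrict hs hsd' hr hrR x⟩
    (fun k p ⟨hpo, hpx, hpS, hp⟩ => by
      obtain ⟨S', ν', hν', hS'O, hS'Ω⟩ := hp.exists_next h hs hα hsd hε_pos hε hC₁ hA (hMk0 k)
        (hMk_lt k) hm_top hpo hpS
        ⟨_, h.isCompact_closedBall x hrR, hpx.trans Metric.ball_subset_closedBall⟩ k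
      obtain ⟨τ, hτ, hτO⟩ := hν'.isCompact.exists_cthickening_subset_open (hpo.inter (hΩo k))
        (subset_inter hS'O hS'Ω)
      have hcl : closure (Metric.thickening τ S') ⊆ p.1 ∩ Ω k :=
        (Metric.closure_thickening_subset_cthickening _ _).trans hτO
      exact ⟨(Metric.thickening τ S', S', ν'), ⟨Metric.isOpen_thickening,
        subset_closure.trans (hcl.trans (inter_subset_left.trans hpx)),
        Metric.self_subset_thickening hτ _, hν'⟩, hcl⟩)
  have hstep : ∀ k, closure (f (k + 1)).1 ⊆ (f k).1 ∩ Ω k := fun k => (hf k).2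
  have hcompact : ∀ k, IsCompact (closure (f k).1) := fun k =>
    (h.isCompact_closedBall x hrR).closure_of_subset
      ((hf k).1.2.1.trans Metric.ball_subset_closedBall)
  have hmain := le_mul_hausdorffContent_iInter (s := s) (M := 2 * M) (m := m)
    (Z := fun k => closure (f k).1) (ν := fun k => (f k).2.2) hs (by linarith) hcompact
    (antitone_nat_of_succ_le fun k =>
      (hstep k).trans (inter_subset_left.trans subset_closure))
    (fun k => by
      have hk := (hf k).1.2.2.2
      calc m = (f k).2.2 univ := hk.mass.symm
        _ ≤ (f k).2.2 (f k).2.1 + (f k).2.2 (f k).2.1ᶜ := by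
          rw [← union_compl_self (f k).2.1]; exact measure_union_le _ _
        _ = (f k).2.2 (f k).2.1 := by rw [hk.compl_eq_zero, add_zero]
        _ ≤ _ := measure_mono ((hf k).1.2.2.1.trans subset_closure))
    (fun k e t ht => ((hf k).1.2.2.2.growth e t ht).trans (by
      gcongr
      exact hMk_le k))
  have hsub : ⋂ k, closure (f k).1 ⊆ approximablePoints ε α A ∩ Metric.ball x r := by
    intro z hz
    have hz' := fun k => hstep k (mem_iInter.1 hz (k + 1))
    exact ⟨mem_iInter.2 fun k => (hz' k).2, (hf 0).1.2.1 (hz' 0).1⟩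
  have h2 : ENNReal.ofReal (C⁻¹ * (r / 2) ^ d) ≤ ENNReal.ofReal (2 * M) *
      hausdorffContent s (approximablePoints ε α A ∩ Metric.ball x r) :=
    (h.le_measure_closedBall x (by linarith) (by linarith)).trans
      (hmain.trans (by gcongr; exact hausdorffContent_mono s hsub))
  refine (ENNReal.mul_le_mul_iff_right (a := ENNReal.ofReal (2 * M))
    (ENNReal.ofReal_pos.2 (by linarith)).ne' ENNReal.ofReal_ne_top).1 (le_trans (le_of_eq ?_) h2)
  rw [← ENNReal.ofReal_mul (by linarith)]
  congr 1
  have h4 : (4 : ℝ) ^ d = 2 ^ d * 2 ^ d := by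
    rw [← Real.mul_rpow (by norm_num) (by norm_num)]; norm_num
  rw [hM, h4, Real.rpow_sub hr, Real.div_rpow hr.le (by norm_num)]
  have h5 : 0 < r ^ s := Real.rpow_pos_of_pos hr s
  field_simp

end

/-! ### From small balls to open sets: Hausdorff content -/

theorem ENNReal.tsum_tsum_ite_subset_le {α ι : Type*} {P : ι → Set α}
    (hP : Pairwise (Function.onFun Disjoint P)) (t : ℕ → Set α) (g : ℕ → ENNReal)
    [∀ a n, Decidable ((t n).Nonempty ∧ t n ⊆ P a)] :
    ∑' a, ∑' n, (if (t n).Nonempty ∧ t n ⊆ P a then g n else 0) ≤ ∑' n, g n := by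
  rw [ENNReal.tsum_comm]
  refine ENNReal.tsum_le_tsum fun n => ?_
  by_cases h : ∃ a, (t n).Nonempty ∧ t n ⊆ P a
  · obtain ⟨a, ⟨x, hx⟩, ha⟩ := h
    rw [tsum_eq_single a fun b hb => if_neg fun h =>
      (Set.disjoint_left.1 (hP hb) (h.2 hx) (ha hx)).elim]
    split_ifs
    · exact le_rfl
    · exact zero_le
  · push Not at h
    rw [ENNReal.tsum_eq_zero.2 fun a => if_neg fun h' => h a h'.1 h'.2]
    exact zero_le

section

variable {X : Type*} [MetricSpace X]

theorem isGδ_approximablePoints (ε : ℕ → ℝ) (α : ℝ) (A : ℕ → Set X) :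
    IsGδ (approximablePoints ε α A) :=
  IsGδ.iInter_of_isOpen fun _ => isOpen_iUnion fun _ => isOpen_iUnion fun _ =>
    isOpen_biUnion fun _ _ => Metric.isOpen_ball

theorem Metric.ediam_closedBall_le_ofReal (x : X) {r : ℝ} (hr : 0 ≤ r) :
    Metric.ediam (Metric.closedBall x r) ≤ ENNReal.ofReal (2 * r) := by
  rw [← Metric.closedEBall_ofReal hr, ENNReal.ofReal_mul (by norm_num), ENNReal.ofReal_ofNat]
  exact Metric.ediam_closedEBall_le

/-- A lower bound for the Hausdorff content of `F` in small balls gives one in all open sets. Vitali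
balls inside `U` are of two kinds: those close to a comparatively large member of a given covering
of `F ∩ U` are swallowed by an enlargement of this member, and the others contain the members of the
covering that they meet near their centre, so that each member is charged to one ball only. -/
theorem exists_mul_hausdorffContent_le_of_small_balls [TopologicalSpace.SeparableSpace X]
    {F : Set X} {s c r₀ : ℝ} (hs : 0 < s) (hc : 0 < c) (hr₀ : 0 < r₀)
    (hF : ∀ (x : X) (r : ℝ), 0 < r → r ≤ r₀ →
      ENNReal.ofReal (c * r ^ s) ≤ hausdorffContent s (F ∩ Metric.ball x r)) :
    ∃ c' : ℝ, 0 < c' ∧ c' ≤ 1 ∧ ∀ U : Set X, IsOpen U →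
      ENNReal.ofReal c' * hausdorffContent s U ≤ hausdorffContent s (F ∩ U) := by
  classical
  have h23 : (1 : ℝ) ≤ 23 ^ s := Real.one_le_rpow (by norm_num) hs.le
  have h20 : (0 : ℝ) < 20 ^ s / c := by positivity
  set q : ℝ := 23 ^ s + 20 ^ s / c with hq
  have hq1 : 1 ≤ q := by linarith
  refine ⟨q⁻¹, by positivity, inv_le_one_of_one_le₀ hq1, fun U hU => ?_⟩
  refine le_iInf₂ fun t ht => ?_
  rw [ENNReal.ofReal_inv_of_pos (by linarith), mul_comm, ← div_eq_mul_inv]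
  refine ENNReal.div_le_of_le_mul ?_
  have hrad : ∀ x ∈ U, ∃ r : ℝ, 0 < r ∧ r ≤ r₀ ∧ Metric.closedBall x r ⊆ U := fun x hx => by
    obtain ⟨r, hr, hrU⟩ := Metric.nhds_basis_closedBall.mem_iff.1 (hU.mem_nhds hx)
    exact ⟨min r r₀, lt_min hr hr₀, min_le_right _ _,
      (Metric.closedBall_subset_closedBall (min_le_left _ _)).trans hrU⟩
  choose! r hr0 hrr₀ hrU using hrad
  obtain ⟨u, huU, hdisj, hcov⟩ := Vitali.exists_disjoint_subfamily_covering_enlargement_closedBall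
    U id r r₀ hrr₀ 5 (by norm_num)
  simp only [id] at hdisj hcov
  have hucount : u.Countable := hdisj.countable_of_nonempty_interior fun a ha =>
    ⟨a, Metric.ball_subset_interior_closedBall (Metric.mem_ball_self (hr0 a (huU ha)))⟩
  have := hucount.to_subtype
  -- a ball is swallowed if a comparatively large member of the covering comes near its centre
  let big : X → Prop := fun a => ∃ n, (t n ∩ Metric.ball a (r a / 2)).Nonempty ∧
    ENNReal.ofReal (r a / 2) ≤ Metric.ediam (t n)
  let W : ℕ ⊕ u → Set X := Sum.elim
    (fun n => {x | ∃ y ∈ t n, edist x y ≤ 11 * Metric.ediam (t n)})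
    (fun a => if big a then ∅ else Metric.closedBall (a : X) (5 * r a))
  have hUW : U ⊆ ⋃ i, W i := by
    intro x hx
    obtain ⟨a, ha, hxa⟩ := hcov x hx
    replace hxa := hxa (Metric.mem_closedBall_self (hr0 x hx).le)
    by_cases hb : big a
    · obtain ⟨n, ⟨y, hyt, hya⟩, hn⟩ := hb
      refine mem_iUnion.2 ⟨Sum.inl n, y, hyt, ?_⟩
      have h1 : dist x y ≤ 11 * (r a / 2) := by
        have h2 := dist_triangle x a y
        rw [Metric.mem_closedBall] at hxa
        rw [Metric.mem_ball, dist_comm] at hya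
        linarith
      calc edist x y = ENNReal.ofReal (dist x y) := edist_dist x y
        _ ≤ ENNReal.ofReal (11 * (r a / 2)) := ENNReal.ofReal_le_ofReal h1
        _ = 11 * ENNReal.ofReal (r a / 2) := by
          rw [ENNReal.ofReal_mul (by norm_num), ENNReal.ofReal_ofNat]
        _ ≤ _ := by gcongr
    · refine mem_iUnion.2 ⟨Sum.inr ⟨a, ha⟩, ?_⟩
      simp only [W, Sum.elim_inr, if_neg hb]
      exact hxa
  have hinl : ∀ n, Metric.ediam (W (Sum.inl n)) ^ s ≤
      ENNReal.ofReal (23 ^ s) * Metric.ediam (t n) ^ s := by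
    intro n
    have : Metric.ediam (W (Sum.inl n)) ≤ 23 * Metric.ediam (t n) := by
      refine Metric.ediam_le ?_
      rintro x ⟨x', hx', hxx'⟩ y ⟨y', hy', hyy'⟩
      calc edist x y ≤ edist x x' + edist x' y' + edist y' y := edist_triangle4 x x' y' y
        _ ≤ 11 * Metric.ediam (t n) + Metric.ediam (t n) + 11 * Metric.ediam (t n) := by
          gcongr
          · exact Metric.edist_le_ediam_of_mem hx' hy'
          · rwa [edist_comm]
        _ = 23 * Metric.ediam (t n) := by ring
    calc _ ≤ (23 * Metric.ediam (t n)) ^ s := by gcongr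
      _ = _ := by
        rw [ENNReal.mul_rpow_of_nonneg _ _ hs.le,
          ← ENNReal.ofReal_rpow_of_pos (by norm_num), ENNReal.ofReal_ofNat]
  have hinr : ∀ a : u, Metric.ediam (W (Sum.inr a)) ^ s ≤ ENNReal.ofReal (20 ^ s / c) *
      ∑' n, (if (t n).Nonempty ∧ t n ⊆ Metric.closedBall (a : X) (r a)
        then Metric.ediam (t n) ^ s else 0) := by
    intro a
    have ha0 := hr0 a (huU a.2)
    by_cases hb : big a
    · simp [W, if_pos hb, ENNReal.zero_rpow_of_pos hs]
    have hsub : F ∩ Metric.ball (a : X) (r a / 2) ⊆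
        ⋃ n, if (t n).Nonempty ∧ t n ⊆ Metric.closedBall (a : X) (r a) then t n else ∅ := by
      rintro x ⟨hxF, hxa⟩
      have hxU : x ∈ U := hrU a (huU a.2) (Metric.ball_subset_closedBall
        (Metric.ball_subset_ball (by linarith) hxa))
      obtain ⟨n, hn⟩ := mem_iUnion.1 (ht ⟨hxF, hxU⟩)
      refine mem_iUnion.2 ⟨n, ?_⟩
      have hlt : Metric.ediam (t n) < ENNReal.ofReal (r a / 2) := by
        by_contra! hle
        exact hb ⟨n, ⟨x, hn, hxa⟩, hle⟩
      rw [if_pos]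
      · exact hn
      · refine ⟨⟨x, hn⟩, fun z hz => ?_⟩
        have h1 := (Metric.edist_le_ediam_of_mem hz hn).trans_lt hlt
        rw [edist_dist, ENNReal.ofReal_lt_ofReal_iff (by linarith)] at h1
        have h2 := dist_triangle z x a
        rw [Metric.mem_ball] at hxa
        rw [Metric.mem_closedBall]
        linarith
    have h1 := (hF a (r a / 2) (by linarith) (by linarith [hrr₀ a (huU a.2)])).trans
      (hausdorffContent_le_tsum hs _ hsub)
    have h2 : ∀ n, Metric.ediam (if (t n).Nonempty ∧ t n ⊆ Metric.closedBall (a : X) (r a)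
        then t n else ∅) ^ s = if (t n).Nonempty ∧ t n ⊆ Metric.closedBall (a : X) (r a)
        then Metric.ediam (t n) ^ s else 0 := fun n => by
      split_ifs
      · rfl
      · rw [Metric.ediam_empty, ENNReal.zero_rpow_of_pos hs]
    simp only [h2] at h1
    calc Metric.ediam (W (Sum.inr a)) ^ s ≤ ENNReal.ofReal (2 * (5 * r a)) ^ s := by
          gcongr
          simp only [W, Sum.elim_inr, if_neg hb]
          exact Metric.ediam_closedBall_le_ofReal _ (by linarith)
      _ = ENNReal.ofReal (20 ^ s / c) * ENNReal.ofReal (c * (r a / 2) ^ s) := by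
          rw [← ENNReal.ofReal_mul (by positivity), ENNReal.ofReal_rpow_of_pos (by linarith)]
          congr 1
          rw [show 2 * (5 * r a) = 20 * (r a / 2) by ring,
            Real.mul_rpow (by norm_num) (by linarith)]
          field_simp
      _ ≤ _ := by gcongr
  calc hausdorffContent s U ≤ ∑' i, Metric.ediam (W i) ^ s := hausdorffContent_le_tsum hs W hUW
    _ = ∑' n, Metric.ediam (W (Sum.inl n)) ^ s + ∑' a, Metric.ediam (W (Sum.inr a)) ^ s :=
        Summable.tsum_sum ENNReal.summable ENNReal.summable
    _ ≤ ENNReal.ofReal (23 ^ s) * ∑' n, Metric.ediam (t n) ^ s +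
        ENNReal.ofReal (20 ^ s / c) * ∑' n, Metric.ediam (t n) ^ s := by
        gcongr
        · rw [← ENNReal.tsum_mul_left]
          exact ENNReal.tsum_le_tsum hinl
        · refine (ENNReal.tsum_le_tsum hinr).trans ?_
          rw [ENNReal.tsum_mul_left]
          gcongr
          exact ENNReal.tsum_tsum_ite_subset_le
            (P := fun a : u => Metric.closedBall (a : X) (r a))
            (fun a b hab => hdisj a.2 b.2 fun e => hab (Subtype.ext e)) t _
    _ = (∑' n, Metric.ediam (t n) ^ s) * ENNReal.ofReal q := by
        rw [hq, ENNReal.ofReal_add (by positivity) h20.le]; ring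

/-! ### From small balls to open sets: net content -/

variable [MeasurableSpace X] {μ : Measure X} {d C R s : ℝ}

theorem netContent_le_tsum (𝒬 : DyadicDecomposition X) (μ : Measure X) (hd : 0 < d) (hs : 0 < s)
    {ι : Type*} [Countable ι] {t : ι → Set X} (ht : ∀ i, t i = ∅ ∨ ∃ j, t i ∈ 𝒬.cubes j)
    {E : Set X} (h : E ⊆ ⋃ i, t i) : netContent 𝒬 μ d s E ≤ ∑' i, μ (t i) ^ (s / d) := by
  obtain ⟨f, hf⟩ := exists_injective_nat ι
  have hout : ∀ n, n ∉ range f → Function.extend f t (fun _ => ∅) n = ∅ := fun n hn =>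
    Function.extend_apply' _ _ _ (by simpa using hn)
  refine (iInf_le_of_le (Function.extend f t fun _ => ∅) (iInf₂_le (fun n => ?_)
    fun x hx => ?_)).trans (le_of_eq ?_)
  · by_cases hn : n ∈ range f
    · obtain ⟨i, rfl⟩ := hn
      rw [hf.extend_apply]
      exact ht i
    · exact Or.inl (hout n hn)
  · obtain ⟨i, hi⟩ := mem_iUnion.1 (h hx)
    exact mem_iUnion.2 ⟨f i, by rwa [hf.extend_apply]⟩
  · rw [← hf.tsum_eq (f := fun n => μ (Function.extend f t (fun _ => ∅) n) ^ (s / d))]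
    · simp [hf.extend_apply]
    · intro n hn
      by_contra hn'
      rw [Function.mem_support, hout n hn', measure_empty,
        ENNReal.zero_rpow_of_pos (by positivity)] at hn
      exact hn rfl

namespace DyadicDecomposition

variable (𝒬 : DyadicDecomposition X)

theorem ediam_rpow_le (h : IsRegularUpTo μ d C R) (hs : 0 < s) :
    ∃ c : ℝ, 0 < c ∧ ∀ j, ∀ Q ∈ 𝒬.cubes j,
      Metric.ediam Q ^ s ≤ ENNReal.ofReal c * μ Q ^ (s / d) := by
  have hC0 := h.C_pos
  have hd := h.d_pos
  have hδ := 𝒬.δ_pos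
  have hK : 0 < 𝒬.K := one_pos.trans_le 𝒬.one_le_K
  -- the factor `κ` brings the inner radius of a cube down to a scale where `μ` is controlled
  set κ := min 1 R with hκ
  have hκ0 : 0 < κ := lt_min one_pos h.R_pos
  refine ⟨(2 * 𝒬.K) ^ s / κ ^ s * C ^ (s / d), by positivity, fun j Q hQ => ?_⟩
  obtain ⟨x, -, hxQ, hQx⟩ := 𝒬.quasiBall j Q hQ
  have hj : 0 < 𝒬.δ ^ j := pow_pos hδ j
  have hj1 : 𝒬.δ ^ j ≤ 1 := pow_le_one₀ hδ.le 𝒬.δ_lt_one.le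
  have hμ : ENNReal.ofReal (C⁻¹ * (κ * 𝒬.δ ^ j) ^ d) ≤ μ Q :=
    (h.le_measure_ball x _ (by positivity) ((mul_le_of_le_one_right hκ0.le hj1).trans
      (min_le_right _ _))).trans (measure_mono ((Metric.ball_subset_ball
      (mul_le_of_le_one_left hj.le (min_le_left _ _))).trans hxQ))
  calc Metric.ediam Q ^ s ≤ ENNReal.ofReal (2 * (𝒬.K * 𝒬.δ ^ j)) ^ s := by
        gcongr
        exact (Metric.ediam_mono (hQx.trans Metric.ball_subset_closedBall)).trans
          (Metric.ediam_closedBall_le_ofReal x (by positivity))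
    _ = ENNReal.ofReal ((2 * 𝒬.K) ^ s / κ ^ s * C ^ (s / d)) *
        ENNReal.ofReal (C⁻¹ * (κ * 𝒬.δ ^ j) ^ d) ^ (s / d) := by
        rw [ENNReal.ofReal_rpow_of_pos (by positivity), ENNReal.ofReal_rpow_of_pos (by positivity),
          ← ENNReal.ofReal_mul (by positivity)]
        congr 1
        have h1 : ((κ * 𝒬.δ ^ j) ^ d) ^ (s / d) = κ ^ s * (𝒬.δ ^ j) ^ s := by
          rw [← Real.rpow_mul (by positivity), mul_div_cancel₀ _ hd.ne',
            Real.mul_rpow hκ0.le hj.le]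
        rw [Real.mul_rpow (x := C⁻¹) (by positivity) (by positivity), h1, Real.inv_rpow hC0.le,
          ← mul_assoc 2, Real.mul_rpow (by positivity) hj.le]
        have h2 : 0 < C ^ (s / d) := by positivity
        have h3 : 0 < κ ^ s := by positivity
        field_simp
    _ ≤ _ := by gcongr

/-- An open set is the disjoint union of the maximal cubes of level at least `j₀` that it
contains. -/
theorem exists_disjoint_cubes [TopologicalSpace.SeparableSpace X] (j₀ : ℕ) {U : Set X}
    (hU : IsOpen U) : ∃ u : Set (Set X), u.Countable ∧ u.PairwiseDisjoint id ∧
      (∀ P ∈ u, ∃ j, j₀ ≤ j ∧ P ∈ 𝒬.cubes j) ∧ ⋃₀ u = U := by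
  classical
  set 𝒞 : Set (Set X) := {P | P ⊆ U ∧ ∃ j, j₀ ≤ j ∧ P ∈ 𝒬.cubes j} with h𝒞
  set u : Set (Set X) := {P ∈ 𝒞 | ∀ P' ∈ 𝒞, P ⊆ P' → P' = P} with hu
  have hδ := 𝒬.δ_pos
  have hK : 0 < 𝒬.K := one_pos.trans_le 𝒬.one_le_K
  have hdisj : u.PairwiseDisjoint id := by
    rintro P ⟨hP, hPmax⟩ P' ⟨hP', hPmax'⟩ hne
    obtain ⟨-, j, -, hj⟩ := id hP
    obtain ⟨-, j', -, hj'⟩ := id hP'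
    rcases le_total j j' with hjj | hjj
    · rcases 𝒬.nested j' j hjj P' hj' P hj with h1 | h1
      · exact absurd (hPmax' P hP h1) hne
      · exact h1.symm
    · rcases 𝒬.nested j j' hjj P hj P' hj' with h1 | h1
      · exact absurd (hPmax P' hP' h1).symm hne
      · exact h1
  refine ⟨u, hdisj.countable_of_nonempty_interior ?_, hdisj, fun P hP => hP.1.2,
    subset_antisymm (sUnion_subset fun P hP => hP.1.1) fun x hx => ?_⟩
  · rintro P ⟨⟨-, j, -, hj⟩, -⟩
    obtain ⟨y, -, hyP, -⟩ := 𝒬.quasiBall j P hj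
    exact ⟨y, interior_maximal hyP Metric.isOpen_ball (Metric.mem_ball_self (pow_pos hδ j))⟩
  · have hex : ∃ j, j₀ ≤ j ∧ ∃ P ∈ 𝒬.cubes j, x ∈ P ∧ P ⊆ U := by
      obtain ⟨r, hr, hrU⟩ := Metric.isOpen_iff.1 hU x hx
      have hlim : Tendsto (fun j => 2 * 𝒬.K * 𝒬.δ ^ j) atTop (𝓝 0) := by
        simpa using (tendsto_pow_atTop_nhds_zero_of_lt_one hδ.le 𝒬.δ_lt_one).const_mul (2 * 𝒬.K)
      obtain ⟨j, hj, hj₀⟩ := ((hlim.eventually (gt_mem_nhds hr)).and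
        (eventually_ge_atTop j₀)).exists
      obtain ⟨P, hP, hxP⟩ := mem_sUnion.1 ((𝒬.covers j).symm ▸ mem_univ x)
      obtain ⟨y, -, -, hPy⟩ := 𝒬.quasiBall j P hP
      refine ⟨j, hj₀, P, hP, hxP, fun z hz => hrU ?_⟩
      have h1 := Metric.mem_ball.1 (hPy hxP)
      have h2 := Metric.mem_ball.1 (hPy hz)
      rw [Metric.mem_ball]
      have := dist_triangle_right z x y
      linarith
    obtain ⟨hj₀, P, hP, hxP, hPU⟩ := Nat.find_spec hex
    refine mem_sUnion.2 ⟨P, ⟨⟨hPU, _, hj₀, hP⟩, ?_⟩, hxP⟩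
    rintro P' ⟨hP'U, j', hj', hP'⟩ hPP'
    have hle := Nat.find_min' hex ⟨hj', P', hP', hPP' hxP, hP'U⟩
    rcases 𝒬.nested _ _ hle P' hP' P hP with h1 | h1
    · exact subset_antisymm h1 hPP'
    · exact (Set.disjoint_left.1 h1 (hPP' hxP) hxP).elim

/-- The analogue of `exists_mul_hausdorffContent_le_of_small_balls` for net contents. It suffices to
decompose `U` into cubes of small diameter: each of them either lies in a cube of the covering or
contains the cubes of the covering that it meets. -/
theorem exists_mul_netContent_le_of_small_balls [TopologicalSpace.SeparableSpace X]
    (h : IsRegularUpTo μ d C R) {F : Set X} {c r₀ : ℝ} (hs : 0 < s) (hc : 0 < c) (hr₀ : 0 < r₀)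
    (hF : ∀ (x : X) (r : ℝ), 0 < r → r ≤ r₀ →
      ENNReal.ofReal (c * r ^ s) ≤ hausdorffContent s (F ∩ Metric.ball x r)) :
    ∃ c' : ℝ, 0 < c' ∧ c' ≤ 1 ∧ ∀ U : Set X, IsOpen U →
      ENNReal.ofReal c' * netContent 𝒬 μ d s U ≤ netContent 𝒬 μ d s (F ∩ U) := by
  classical
  have hC0 := h.C_pos
  have hd := h.d_pos
  have hδ := 𝒬.δ_pos
  have hK : 0 < 𝒬.K := one_pos.trans_le 𝒬.one_le_K
  obtain ⟨c₁, hc₁, hdiam⟩ := 𝒬.ediam_rpow_le h hs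
  set c₀ := C ^ (s / d) * 𝒬.K ^ s / c with hc₀
  have hc₀0 : 0 < c₀ := by positivity
  set q : ℝ := 1 + c₀ * c₁ with hq
  have hq0 : 0 < c₀ * c₁ := by positivity
  have hq1 : 1 ≤ q := by linarith
  refine ⟨q⁻¹, by positivity, inv_le_one_of_one_le₀ hq1, fun U hU => ?_⟩
  refine le_iInf fun t => le_iInf₂ fun htQ ht => ?_
  rw [ENNReal.ofReal_inv_of_pos (by linarith), mul_comm, ← div_eq_mul_inv]
  refine ENNReal.div_le_of_le_mul ?_
  obtain ⟨j₀, hj₀⟩ : ∃ j₀ : ℕ, ∀ j ≥ j₀, 𝒬.δ ^ j ≤ r₀ ∧ 𝒬.K * 𝒬.δ ^ j ≤ R := by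
    have hlim := tendsto_pow_atTop_nhds_zero_of_lt_one hδ.le 𝒬.δ_lt_one
    have hlim' : Tendsto (fun j => 𝒬.K * 𝒬.δ ^ j) atTop (𝓝 0) := by
      simpa using hlim.const_mul 𝒬.K
    exact eventually_atTop.1 (((hlim.eventually (gt_mem_nhds hr₀)).and
      (hlim'.eventually (gt_mem_nhds h.R_pos))).mono fun j hj => ⟨hj.1.le, hj.2.le⟩)
  obtain ⟨u, hucount, hdisj, hucube, huU⟩ := 𝒬.exists_disjoint_cubes j₀ hU
  have := hucount.to_subtype
  let W : ℕ ⊕ u → Set X := Sum.elim t (fun P => if ∃ n, (P : Set X) ⊆ t n then ∅ else P)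
  have hWQ : ∀ i, W i = ∅ ∨ ∃ j, W i ∈ 𝒬.cubes j := by
    rintro (n | P)
    · exact htQ n
    · simp only [W, Sum.elim_inr]
      split_ifs
      · exact Or.inl rfl
      · obtain ⟨j, -, hj⟩ := hucube P P.2
        exact Or.inr ⟨j, hj⟩
  have hUW : U ⊆ ⋃ i, W i := by
    rw [← huU]
    refine sUnion_subset fun P hP => ?_
    by_cases hb : ∃ n, P ⊆ t n
    · obtain ⟨n, hn⟩ := hb
      exact hn.trans (subset_iUnion W (Sum.inl n))
    · refine Subset.trans ?_ (subset_iUnion W (Sum.inr ⟨P, hP⟩))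
      simp only [W, Sum.elim_inr, if_neg hb]
      exact Subset.rfl
  have hinr : ∀ P : u, μ (W (Sum.inr P)) ^ (s / d) ≤ ENNReal.ofReal (c₀ * c₁) *
      ∑' n, (if (t n).Nonempty ∧ t n ⊆ (P : Set X) then μ (t n) ^ (s / d) else 0) := by
    intro P
    by_cases hb : ∃ n, (P : Set X) ⊆ t n
    · simp only [W, Sum.elim_inr, if_pos hb, measure_empty]
      rw [ENNReal.zero_rpow_of_pos (by positivity)]
      exact zero_le
    obtain ⟨j, hj, hPj⟩ := hucube P P.2
    obtain ⟨hjr₀, hjR⟩ := hj₀ j hj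
    obtain ⟨x, -, hxP, hPx⟩ := 𝒬.quasiBall j P hPj
    have hδj : 0 < 𝒬.δ ^ j := pow_pos hδ j
    have hsub : F ∩ P ⊆ ⋃ n, if (t n).Nonempty ∧ t n ⊆ (P : Set X) then t n else ∅ := by
      rintro y ⟨hyF, hyP⟩
      have hyU : y ∈ U := huU ▸ mem_sUnion_of_mem hyP P.2
      obtain ⟨n, hn⟩ := mem_iUnion.1 (ht ⟨hyF, hyU⟩)
      refine mem_iUnion.2 ⟨n, ?_⟩
      rw [if_pos]
      · exact hn
      · refine ⟨⟨y, hn⟩, ?_⟩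
        rcases htQ n with he | ⟨i, hi⟩
        · rw [he] at hn; exact hn.elim
        · rcases le_total i j with hij | hij
          · rcases 𝒬.nested j i hij P hPj _ hi with h1 | h1
            · exact absurd ⟨n, h1⟩ hb
            · exact (Set.disjoint_left.1 h1 hyP hn).elim
          · rcases 𝒬.nested i j hij _ hi P hPj with h1 | h1
            · exact h1
            · exact (Set.disjoint_left.1 h1 hn hyP).elim
    have h2 : ∀ n, Metric.ediam (if (t n).Nonempty ∧ t n ⊆ (P : Set X) then t n else ∅) ^ s ≤
        ENNReal.ofReal c₁ *
          if (t n).Nonempty ∧ t n ⊆ (P : Set X) then μ (t n) ^ (s / d) else 0 := fun n => by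
      split_ifs with hn
      · rcases htQ n with he | ⟨i, hi⟩
        · rw [he] at hn; exact absurd hn.1 (by simp)
        · exact hdiam i _ hi
      · rw [Metric.ediam_empty, ENNReal.zero_rpow_of_pos hs]
        exact zero_le
    calc μ (W (Sum.inr P)) ^ (s / d) ≤ ENNReal.ofReal (C * (𝒬.K * 𝒬.δ ^ j) ^ d) ^ (s / d) := by
          simp only [W, Sum.elim_inr, if_neg hb]
          gcongr
          exact (measure_mono hPx).trans (h.measure_ball_le x _ (by positivity) hjR)
      _ = ENNReal.ofReal c₀ * ENNReal.ofReal (c * (𝒬.δ ^ j) ^ s) := by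
          rw [ENNReal.ofReal_rpow_of_pos (by positivity), ← ENNReal.ofReal_mul hc₀0.le]
          congr 1
          rw [Real.mul_rpow hC0.le (by positivity), ← Real.rpow_mul (by positivity),
            mul_div_cancel₀ _ hd.ne', Real.mul_rpow hK.le hδj.le, hc₀]
          field_simp
      _ ≤ ENNReal.ofReal c₀ * (ENNReal.ofReal c₁ *
          ∑' n, (if (t n).Nonempty ∧ t n ⊆ (P : Set X) then μ (t n) ^ (s / d) else 0)) := by
          gcongr
          refine (hF x _ hδj hjr₀).trans ((hausdorffContent_mono s
            ((inter_subset_inter_right F hxP).trans hsub)).trans ?_)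
          refine (hausdorffContent_le_tsum hs _ Subset.rfl).trans ?_
          rw [← ENNReal.tsum_mul_left]
          exact ENNReal.tsum_le_tsum h2
      _ = _ := by rw [ENNReal.ofReal_mul hc₀0.le, mul_assoc]
  calc netContent 𝒬 μ d s U ≤ ∑' i, μ (W i) ^ (s / d) := netContent_le_tsum 𝒬 μ hd hs hWQ hUW
    _ = ∑' n, μ (t n) ^ (s / d) + ∑' P, μ (W (Sum.inr P)) ^ (s / d) :=
        Summable.tsum_sum ENNReal.summable ENNReal.summable
    _ ≤ ∑' n, μ (t n) ^ (s / d) + ENNReal.ofReal (c₀ * c₁) * ∑' n, μ (t n) ^ (s / d) := by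
        gcongr
        refine (ENNReal.tsum_le_tsum hinr).trans ?_
        rw [ENNReal.tsum_mul_left]
        gcongr
        exact ENNReal.tsum_tsum_ite_subset_le (P := fun P : u => (P : Set X))
          (fun a b hab => hdisj a.2 b.2 fun e => hab (Subtype.ext e)) t _
    _ = (∑' n, μ (t n) ^ (s / d)) * ENNReal.ofReal q := by
        rw [hq, ENNReal.ofReal_add zero_le_one hq0.le, ENNReal.ofReal_one]; ring

end DyadicDecomposition

end

/-! ### Hausdorff dimension -/

open Measure in
theorem hausdorffContent_le_hausdorffMeasure {X : Type*} [MetricSpace X] [MeasurableSpace X]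
    [BorelSpace X] {s : ℝ} (hs : 0 < s) (E : Set X) : hausdorffContent s E ≤ μH[s] E := by
  rw [hausdorffMeasure_apply]
  refine le_trans ?_ (le_iSup₂ (⊤ : ENNReal) ENNReal.zero_lt_top)
  refine le_iInf fun t => le_iInf₂ fun ht _ => (iInf₂_le t ht).trans ?_
  refine ENNReal.tsum_le_tsum fun n => ?_
  rcases (t n).eq_empty_or_nonempty with h | h
  · rw [h, Metric.ediam_empty, ENNReal.zero_rpow_of_pos hs]
    exact zero_le
  · exact le_iSup (fun _ : (t n).Nonempty => Metric.ediam (t n) ^ s) h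

theorem HasExponentialDecay.eventually_le {ε : ℕ → ℝ} (h : HasExponentialDecay ε)
    (hε_pos : ∀ j, 0 < ε j) : ∃ q : ℝ, 0 < q ∧ ∀ᶠ j in atTop, ε j ≤ Real.exp (-q * j) := by
  obtain ⟨b, hb, hb0⟩ := EReal.lt_iff_exists_real_btwn.1 h
  have hb0 : b < 0 := by exact_mod_cast hb0
  refine ⟨-b, by linarith, ?_⟩
  filter_upwards [eventually_lt_of_limsup_lt hb, eventually_gt_atTop 0] with j hj hj0
  have hj : Real.log (ε j) / j < b := by exact_mod_cast hj
  have hj0 : (0 : ℝ) < j := by exact_mod_cast hj0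
  rw [div_lt_iff₀ hj0] at hj
  rw [neg_neg]
  exact ((Real.log_lt_iff_lt_exp (hε_pos j)).1 hj).le

section

variable {X : Type*} [MetricSpace X] [MeasurableSpace X] {μ : Measure X} {d C R : ℝ}

/-- A net of scale `ε` has at most a constant times `ε ^ (-d)` points in a small ball; this is
phrased as a bound for the sum of `ε ^ (p + d)` over these points. -/
theorem IsRegularUpTo.tsum_net_le [OpensMeasurableSpace X] (h : IsRegularUpTo μ d C R)
    {c₁ ε r : ℝ} (hc₁ : 0 < c₁) (hε : 0 < ε) (hr : 0 < r) (hrR : 2 * r ≤ R) (hεr : c₁ * ε ≤ r)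
    {A : Set X} (hA : ∀ x ∈ A, ∀ y ∈ A, x ≠ y → 2 * c₁ * ε < dist x y) (x : X) {a : ℝ}
    (ha : 0 ≤ a) (p : ℝ) :
    ∑' _ : (A ∩ Metric.ball x r : Set X), ENNReal.ofReal (a * ε ^ (p + d)) ≤
      ENNReal.ofReal (a * C ^ 2 * (2 * r / c₁) ^ d * ε ^ p) := by
  have hC0 := h.C_pos
  have h1 : ENNReal.ofReal (a * ε ^ (p + d)) =
      ENNReal.ofReal (C⁻¹ * (c₁ * ε) ^ d) * ENNReal.ofReal (a * C / c₁ ^ d * ε ^ p) := by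
    rw [← ENNReal.ofReal_mul (by positivity), Real.mul_rpow hc₁.le hε.le, Real.rpow_add hε]
    congr 1
    have : 0 < c₁ ^ d := by positivity
    field_simp
  have h2 : ∑' _ : (A ∩ Metric.ball x r : Set X), ENNReal.ofReal (C⁻¹ * (c₁ * ε) ^ d) ≤
      ENNReal.ofReal (C * (2 * r) ^ d) :=
    calc _ ≤ ∑' y : (A ∩ Metric.ball x r : Set X), μ (Metric.ball (y : X) (c₁ * ε)) :=
          ENNReal.tsum_le_tsum fun y => h.le_measure_ball y _ (by positivity) (by linarith)
      _ ≤ μ (⋃ y : (A ∩ Metric.ball x r : Set X), Metric.ball (y : X) (c₁ * ε)) := by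
          refine tsum_meas_le_meas_iUnion_of_disjoint μ
            (fun _ => Metric.isOpen_ball.measurableSet) fun y z hyz => ?_
          refine Metric.ball_disjoint_ball ?_
          linarith [hA y y.2.1 z z.2.1 fun e => hyz (Subtype.ext e)]
      _ ≤ μ (Metric.ball x (2 * r)) := by
          refine measure_mono (iUnion_subset fun y => Metric.ball_subset_ball' ?_)
          linarith [Metric.mem_ball.1 y.2.2]
      _ ≤ _ := h.measure_ball_le x _ (by linarith) hrR
  rw [h1, ENNReal.tsum_mul_right]
  calc _ ≤ ENNReal.ofReal (C * (2 * r) ^ d) * ENNReal.ofReal (a * C / c₁ ^ d * ε ^ p) := by gcongr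
    _ = _ := by
      rw [← ENNReal.ofReal_mul (by positivity), Real.div_rpow (by positivity) hc₁.le]
      congr 1
      ring

/-- The natural coverings of the approximable points in a small ball by the approximating balls
themselves, with exponentially decaying radii. -/
theorem IsRegularUpTo.hausdorffMeasure_approximablePoints_inter_ball [BorelSpace X]
    [TopologicalSpace.SeparableSpace X] (h : IsRegularUpTo μ d C R) {α t : ℝ} (hα : 1 ≤ α)
    (ht : d < α * t) {ε : ℕ → ℝ} (hε_pos : ∀ j, 0 < ε j) {q : ℝ} (hq : 0 < q)
    (hεq : ∀ᶠ j in atTop, ε j ≤ Real.exp (-q * j)) {c₁ : ℝ} (hc₁ : 0 < c₁)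
    {A : ℕ → Set X} (hA : ∀ j, ∀ x ∈ A j, ∀ y ∈ A j, x ≠ y → 2 * c₁ * ε j < dist x y) (x : X) :
    Measure.hausdorffMeasure t (approximablePoints ε α A ∩ Metric.ball x (R / 4)) = 0 := by
  have hC0 := h.C_pos
  have hd := h.d_pos
  have hR := h.R_pos
  have ht0 : 0 < t := by
    by_contra! hle
    nlinarith
  have hexp : ∀ a : ℝ, 0 < a → Tendsto (fun j : ℕ => Real.exp (-a * j)) atTop (𝓝 0) := fun a ha =>
    Real.tendsto_exp_atBot.comp (tendsto_natCast_atTop_atTop.const_mul_atTop_of_neg (by linarith))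
  have hcount : ∀ i, (A i).Countable := fun i => by
    refine Set.PairwiseDisjoint.countable_of_isOpen (s := fun y => Metric.ball y (c₁ * ε i))
      (fun y hy z hz hyz => Metric.ball_disjoint_ball ?_) (fun _ _ => Metric.isOpen_ball)
      fun y _ => ⟨y, Metric.mem_ball_self (mul_pos hc₁ (hε_pos i))⟩
    linarith [hA i y hy z hz hyz]
  have : ∀ i, Countable (A i ∩ Metric.ball x (R / 2) : Set X) := fun i =>
    ((hcount i).mono inter_subset_left).to_subtype
  set p := α * t - d with hp
  have hp0 : 0 < p := by linarith
  set Q := 2 ^ t * C ^ 2 * (2 * (R / 2) / c₁) ^ d with hQ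
  -- at all late levels the radii are small and the net points can be counted
  have hsmall : ∀ᶠ j in atTop, ∀ i ≥ j, ε i ≤ Real.exp (-q * i) ∧ ε i ^ α ≤ ε i ∧
      ε i ≤ R / 4 ∧ c₁ * ε i ≤ R / 2 := by
    refine eventually_forall_ge_atTop.2 ?_
    have hlim : Tendsto (fun j : ℕ => c₁ * Real.exp (-q * j)) atTop (𝓝 0) := by
      simpa using (hexp q hq).const_mul c₁
    filter_upwards [hεq, (hexp q hq).eventually (gt_mem_nhds one_pos),
      (hexp q hq).eventually (gt_mem_nhds (show 0 < R / 4 by linarith)),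
      hlim.eventually (gt_mem_nhds (show 0 < R / 2 by linarith))] with j h1 h2 h3 h4
    refine ⟨h1, ?_, h1.trans h3.le, (mul_le_mul_of_nonneg_left h1 hc₁.le).trans h4.le⟩
    have := Real.rpow_le_rpow_of_exponent_ge (hε_pos j) (h1.trans h2.le) hα
    rwa [Real.rpow_one] at this
  have hsum : ∑' i, ENNReal.ofReal (Q * ε i ^ p) ≠ ⊤ := by
    refine Summable.tsum_ofReal_ne_top (Summable.mul_left Q ?_)
    refine Summable.of_norm_bounded_eventually_nat (g := fun j => Real.exp (-q * p) ^ j)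
      (summable_geometric_of_lt_one (Real.exp_pos _).le (Real.exp_lt_one_iff.2 (by nlinarith))) ?_
    filter_upwards [hεq] with j hj
    rw [Real.norm_of_nonneg (Real.rpow_nonneg (hε_pos j).le p)]
    calc ε j ^ p ≤ Real.exp (-q * j) ^ p := Real.rpow_le_rpow (hε_pos j).le hj hp0.le
      _ = Real.exp (-q * p) ^ j := by
        rw [← Real.exp_mul, ← Real.exp_nat_mul]; congr 1; ring
  have hdiam : ∀ i (y : X), Metric.ediam (Metric.ball y (ε i ^ α)) ≤
      ENNReal.ofReal (2 * ε i ^ α) := fun i y =>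
    (Metric.ediam_mono Metric.ball_subset_closedBall).trans
      (Metric.ediam_closedBall_le_ofReal y (Real.rpow_nonneg (hε_pos i).le α))
  refine le_antisymm ?_ zero_le
  have hcover := Measure.hausdorffMeasure_le_liminf_tsum (l := atTop) t
    (approximablePoints ε α A ∩ Metric.ball x (R / 4))
    (ι := fun j : ℕ => Σ n : ℕ, (A (n + j) ∩ Metric.ball x (R / 2) : Set X))
    (fun j : ℕ => ENNReal.ofReal (2 * Real.exp (-q * j)))
    (by
      have := ENNReal.tendsto_ofReal ((hexp q hq).const_mul 2)
      rwa [mul_zero, ENNReal.ofReal_zero] at this)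
    (fun j i => Metric.ball (i.2 : X) (ε (i.1 + j) ^ α))
    (by
      filter_upwards [hsmall] with j hj i
      obtain ⟨h1, h2, -, -⟩ := hj (i.1 + j) (Nat.le_add_left _ _)
      refine (hdiam _ _).trans (ENNReal.ofReal_le_ofReal ?_)
      have h3 : Real.exp (-q * (i.1 + j : ℕ)) ≤ Real.exp (-q * j) := by
        refine Real.exp_le_exp.2 (mul_le_mul_of_nonpos_left ?_ (by linarith))
        exact_mod_cast Nat.le_add_left _ _
      linarith)
    (by
      filter_upwards [hsmall] with j hj
      rintro z ⟨hzF, hzx⟩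
      have hz := mem_iInter.1 hzF j
      simp only [mem_iUnion] at hz
      obtain ⟨i, hij, y, hy, hzy⟩ := hz
      obtain ⟨n, rfl⟩ := Nat.exists_eq_add_of_le' hij
      obtain ⟨-, h2, h3, -⟩ := hj (n + j) hij
      refine mem_iUnion.2 ⟨⟨n, y, hy, ?_⟩, hzy⟩
      rw [Metric.mem_ball] at hzx hzy ⊢
      have := dist_triangle_left y x z
      linarith)
  refine hcover.trans (le_of_eq ?_)
  have hlim : Tendsto (fun j => ∑' i : Σ n : ℕ, (A (n + j) ∩ Metric.ball x (R / 2) : Set X),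
      Metric.ediam (Metric.ball (i.2 : X) (ε (i.1 + j) ^ α)) ^ t) atTop (𝓝 0) := by
    refine tendsto_of_tendsto_of_tendsto_of_le_of_le' tendsto_const_nhds
      (ENNReal.tendsto_sum_nat_add _ hsum) (Eventually.of_forall fun _ => zero_le) ?_
    filter_upwards [hsmall] with j hj
    rw [ENNReal.tsum_sigma']
    refine ENNReal.tsum_le_tsum fun n => ?_
    have hε := hε_pos (n + j)
    refine le_trans (ENNReal.tsum_le_tsum fun y => ?_)
      (h.tsum_net_le hc₁ hε (by linarith) (by linarith)
        (hj (n + j) (Nat.le_add_left _ _)).2.2.2 (hA (n + j)) x (a := 2 ^ t) (by positivity) p)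
    calc _ ≤ ENNReal.ofReal (2 * ε (n + j) ^ α) ^ t := by gcongr; exact hdiam _ _
      _ = _ := by
        rw [ENNReal.ofReal_rpow_of_nonneg (by positivity) ht0.le,
          Real.mul_rpow (by norm_num) (by positivity), ← Real.rpow_mul hε.le, hp, sub_add_cancel]
  exact hlim.liminf_eq

end

/-! ### Large intersections and dimension of the approximable points -/

theorem theorem3 {X : Type*} [MetricSpace X] [MeasurableSpace X] [BorelSpace X]
    [CompleteSpace X] [TopologicalSpace.SeparableSpace X] [Nontrivial X]
    (μ : Measure X) (d : ℝ) (hμ : IsAhlforsRegular μ d)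
    (α : ℝ) (hα : 1 < α)
    (ε : ℕ → ℝ) (hε_pos : ∀ j, 0 < ε j) (hε : Tendsto ε atTop (𝓝 0))
    (c₁ C₁ : ℝ) (hc₁ : 0 < c₁) (hC₁ : 0 < C₁)
    (A : ℕ → Set X) (hA : ∀ j, IsNet c₁ C₁ (ε j) (A j)) :
    (∀ s : ℝ, 0 < s → s < d / α →
        IsGsSet s (approximablePoints ε α A) ∧
          ∀ 𝒬 : DyadicDecomposition X, IsNetGsSet 𝒬 μ d s (approximablePoints ε α A)) ∧
      ENNReal.ofReal (d / α) ≤ dimH (approximablePoints ε α A) ∧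
      (HasExponentialDecay ε → dimH (approximablePoints ε α A) = ENNReal.ofReal (d / α)) := by
  obtain ⟨C, R, h⟩ := hμ.exists_isRegularUpTo
  have hα0 : 0 < α := by linarith
  have hR := h.R_pos
  have hlocal := fun (s : ℝ) (hs : 0 < s) (hsd : s < d / α) =>
    h.exists_le_hausdorffContent_approximablePoints hs hα.le
      (by rwa [lt_div_iff₀' hα0] at hsd) hε_pos hε hC₁ fun j => (hA j).2
  have hlower : ENNReal.ofReal (d / α) ≤ dimH (approximablePoints ε α A) := by
    by_contra! hlt
    obtain ⟨a, ha1, ha2⟩ := ENNReal.lt_iff_exists_nnreal_btwn.1 hlt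
    have ha0 : (0 : ℝ) < a := by
      have : (0 : ENNReal) < a := zero_le.trans_lt ha1
      exact_mod_cast this
    have had : (a : ℝ) < d / α := (ENNReal.lt_ofReal_iff_toReal_lt ENNReal.coe_ne_top).1 ha2
    obtain ⟨c, hc, hcF⟩ := hlocal a ha0 had
    obtain ⟨x⟩ : Nonempty X := inferInstance
    have hne : Measure.hausdorffMeasure (a : ℝ) (approximablePoints ε α A) ≠ 0 := by
      refine (lt_of_lt_of_le ?_ ((hcF x (R / 4) (by linarith) (by linarith)).trans
        ((hausdorffContent_mono _ inter_subset_left).trans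
          (hausdorffContent_le_hausdorffMeasure ha0 _)))).ne'
      exact ENNReal.ofReal_pos.2 (by positivity)
    exact absurd (le_dimH_of_hausdorffMeasure_ne_zero hne) (not_le.2 ha1)
  refine ⟨fun s hs hsd => ?_, hlower, fun hdecay => le_antisymm ?_ hlower⟩
  · obtain ⟨c, hc, hcF⟩ := hlocal s hs hsd
    have hcF' : ∀ (x : X) (r : ℝ), 0 < r → r ≤ R / 4 → ENNReal.ofReal (c * r ^ s) ≤
        hausdorffContent s (approximablePoints ε α A ∩ Metric.ball x r) :=
      fun x r hr hrR => hcF x r hr (by linarith)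
    exact ⟨⟨isGδ_approximablePoints ε α A,
      exists_mul_hausdorffContent_le_of_small_balls hs hc (by linarith) hcF'⟩,
      fun 𝒬 => ⟨isGδ_approximablePoints ε α A,
        𝒬.exists_mul_netContent_le_of_small_balls h hs hc (by linarith) hcF'⟩⟩
  · obtain ⟨q, hq, hεq⟩ := hdecay.eventually_le hε_pos
    have hcov : approximablePoints ε α A =
        ⋃ n, approximablePoints ε α A ∩ Metric.ball (TopologicalSpace.denseSeq X n) (R / 4) := by
      rw [← inter_iUnion, eq_comm, inter_eq_left]
      intro z _
      obtain ⟨n, hn⟩ := (TopologicalSpace.denseRange_denseSeq X).exists_dist_lt z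
        (show 0 < R / 4 by linarith)
      exact mem_iUnion.2 ⟨n, hn⟩
    rw [hcov, dimH_iUnion]
    refine iSup_le fun n => dimH_le fun t htop => ?_
    by_contra! hlt
    have hdt : d / α < t := (ENNReal.ofReal_lt_iff_lt_toReal
      (div_pos h.d_pos hα0).le ENNReal.coe_ne_top).1 hlt
    rw [h.hausdorffMeasure_approximablePoints_inter_ball hα.le
      (by rwa [div_lt_iff₀' hα0] at hdt) hε_pos hq hεq hc₁ (fun j => (hA j).1)] at htop
    exact ENNReal.zero_ne_top htop
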